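/- Let $m\ge 0$, $k\ge 1$ and $N\ge 2$ be integers. Let $\Omega$ be a closed (compact, without boundary) smooth manifold of dimension $m+k$, let $M\subset\Omega$ be a closed smooth embedded submanifold of dimension $m$, and let $\tau\colon\Omega\to\Omega$ be a smooth involution with fixed point set $\Omega^\tau$. Assume that $\Omega^\tau$ is a smooth submanifold of $\Omega$ of dimension $n$ and that $M\cap\Omega^\tau$ is a smooth submanifold of $\Omega$ of dimension $r$, where $r<n$ if $M\cap\Omega^\tau$ is non-empty (the intersection need not be transverse). Let $C^N_\tau(\Omega)$ be the space of functions $F\colon\Omega\to\mathbb{R}$ of class $C^N$ such that $F(\tau u)=F(u)$ for all $u\in\Omega$, with the $C^N$ topology. Let $\mathcal{M}\subset C^N_\tau(\Omega)$ be the set of those $F$ such that (1) $F$ is a Morse function on $\Omega$, that is, all its critical points are nondegenerate; (2) the restriction $F|_M$ is a Morse function on $M$; (3) no critical point of $F$ lies on $M$. Then $\mathcal{M}$ is open and dense in $C^N_\tau(\Omega)$. -/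

import Mathlib

open scoped Manifold ContDiff

noncomputable section

namespace EquivariantMorse

/-- `x` is a critical point of the function `g` on the `d`-dimensional manifold `X`. -/
def IsCriticalPoint (d : ℕ) {X : Type*} [TopologicalSpace X]
    [ChartedSpace (EuclideanSpace ℝ (Fin d)) X] (g : X → ℝ) (x : X) : Prop :=
  mfderiv (𝓡 d) 𝓘(ℝ, ℝ) g x = 0

/-- The matrix of second partial derivatives of `g` at `x`, in the preferred chart at `x`.
At a critical point, its nondegeneracy does not depend on the chart. -/
def hessianMatrix (d : ℕ) {X : Type*} [TopologicalSpace X]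
    [ChartedSpace (EuclideanSpace ℝ (Fin d)) X] (g : X → ℝ) (x : X) :
    Matrix (Fin d) (Fin d) ℝ :=
  Matrix.of fun i j =>
    iteratedFDeriv ℝ 2 (g ∘ (chartAt (EuclideanSpace ℝ (Fin d)) x).symm)
      (chartAt (EuclideanSpace ℝ (Fin d)) x x)
      ![EuclideanSpace.single i 1, EuclideanSpace.single j 1]

/-- All critical points of `g` are nondegenerate. -/
def IsMorse (d : ℕ) {X : Type*} [TopologicalSpace X]
    [ChartedSpace (EuclideanSpace ℝ (Fin d)) X] (g : X → ℝ) : Prop :=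
  ∀ x : X, IsCriticalPoint d g x → (hessianMatrix d g x).det ≠ 0

/-- The subset `S` of the manifold `X` is a (smooth, embedded) submanifold, all of whose components
have dimension `r`. -/
def IsSubmanifold {d : ℕ} {X : Type*} [TopologicalSpace X]
    [ChartedSpace (EuclideanSpace ℝ (Fin d)) X] (r : ℕ) (S : Set X) : Prop :=
  ∃ _ : ChartedSpace (EuclideanSpace ℝ (Fin r)) S, IsManifold (𝓡 r) ∞ S ∧
    Manifold.IsSmoothEmbedding (𝓡 r) (𝓡 d) ∞ (Subtype.val : S → X)

/-- The `C^N` topology on the `C^N` functions on the manifold `X`: the coarsest topology such that,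
for each smooth chart `e` and each `j ≤ N`, the `j`-th derivative of `F` read in the chart `e`
depends continuously on `F`, in the sense of uniform convergence on the compact subsets of the
image of `e`. For compact `X` this is the topology of any of the usual `C^N` norms. -/
abbrev cNTopology (d : ℕ) (X : Type*) [TopologicalSpace X]
    [ChartedSpace (EuclideanSpace ℝ (Fin d)) X] (N : ℕ) :
    TopologicalSpace C^N⟮𝓡 d, X; 𝓘(ℝ, ℝ), ℝ⟯ :=
  ⨅ e ∈ IsManifold.maximalAtlas (𝓡 d) ∞ X, ⨅ j ∈ Set.Iic N,
    TopologicalSpace.induced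
      (fun F : C^N⟮𝓡 d, X; 𝓘(ℝ, ℝ), ℝ⟯ =>
        UniformOnFun.ofFun {K : Set (EuclideanSpace ℝ (Fin d)) | IsCompact K ∧ K ⊆ e.target}
          (iteratedFDeriv ℝ j (F ∘ e.symm)))
      inferInstance

/-- The space of `C^N` functions on `X` which are invariant under `τ`. -/
def InvariantCN (d : ℕ) {X : Type*} [TopologicalSpace X]
    [ChartedSpace (EuclideanSpace ℝ (Fin d)) X] (τ : X → X) (N : ℕ) : Type _ :=
  {F : C^N⟮𝓡 d, X; 𝓘(ℝ, ℝ), ℝ⟯ // ∀ u, F (τ u) = F u}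

instance InvariantCN.instTopologicalSpace (d : ℕ) {X : Type*} [TopologicalSpace X]
    [ChartedSpace (EuclideanSpace ℝ (Fin d)) X] (τ : X → X) (N : ℕ) :
    TopologicalSpace (InvariantCN d τ N) :=
  TopologicalSpace.induced Subtype.val (cNTopology d X N)

/-- The conditions on an embedded equivariant Morse function `F` on `X`, relative to a submanifold
`M` of dimension `m`. -/
structure IsEmbeddedMorse (d m : ℕ) {X : Type*} [TopologicalSpace X]
    [ChartedSpace (EuclideanSpace ℝ (Fin d)) X] (M : Set X)
    [ChartedSpace (EuclideanSpace ℝ (Fin m)) M] (F : X → ℝ) : Prop where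
  /-- `F` is Morse on `X`. -/
  morse : IsMorse d F
  /-- The restriction of `F` to `M` is Morse. -/
  morse_restrict : IsMorse m (fun u : M => F u)
  /-- No critical point of `F` lies on `M`. -/
  not_critical : ∀ u ∈ M, ¬ IsCriticalPoint d F u

end EquivariantMorse

end

open scoped Topology

namespace EquivariantMorse

/-! Each of the three conditions asks that (F, u) lie in an open set of good pairs for all u in a
compact manifold Y (Ω or M). Compactness makes such a condition open and makes its density a local
question. Let Z be the closed set of points of Y fixed by τ. A function that is good along Z is good
near Z, and this survives the small perturbations which then make it good on the compact rest
(`isOpen_and_dense_setOf_forall_mem`).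

Locally, F is perturbed in a finite-dimensional family of invariant functions. Near a point p with τ
p ≠ p every smooth function of the coordinates extends to an invariant one, since p and τ p can be
separated. At a fixed point, averaging over τ keeps the values on fixed points only, so only
coordinates of the fixed set, or of a submanifold of it, are at hand
(`exists_invariant_coordinates`).

Morse conditions: along an r-dimensional piece with parameter y take F + ∑ tᵢ gᵢ + s q, where gᵢ
restricts to yᵢ. The gᵢ give no control of the Hessian transverse to the piece; for this q is a
symmetrized squared distance, with a nondegenerate critical point at the centre. Criticality at y
forces t = -∇F(y) - s ∇q(y), and after substitution the Hessian is a pencil A(y) + s B(y) with B(y)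
invertible. It is singular for finitely many s, so the bad (y, s) form a null set by Fubini, and so
does their image in (t, s)-space, which has the same dimension (`ae_forall_eq_det_ne_zero`,
`dense_morse_along`). Y = Ω gives condition (1), Y = M condition (2).

Condition (3): given n invariant functions with independent differentials along an r-dimensional
piece, criticality of F + ∑ tᵢ gᵢ determines t as a C¹ function of y, whose image has dense
complement as r < n. Off the fixed set the same argument uses m < m + k
(`dense_not_critical_along`). -/

/-- The Hessian matrix of a function on a Euclidean space. -/
noncomputable def hessMat {d : ℕ} (h : EuclideanSpace ℝ (Fin d) → ℝ)
    (y : EuclideanSpace ℝ (Fin d)) : Matrix (Fin d) (Fin d) ℝ :=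
  Matrix.of fun i j =>
    iteratedFDeriv ℝ 2 h y ![EuclideanSpace.single i 1, EuclideanSpace.single j 1]

/-- The function `h` is regular or has a nondegenerate Hessian at `y`. -/
def MorseAt {d : ℕ} (h : EuclideanSpace ℝ (Fin d) → ℝ) (y : EuclideanSpace ℝ (Fin d)) : Prop :=
  fderiv ℝ h y = 0 → (hessMat h y).det ≠ 0

/-! ### The Morse condition in Euclidean coordinates -/

section Hessian

variable {E E' : Type*} [NormedAddCommGroup E] [NormedSpace ℝ E]
  [NormedAddCommGroup E'] [NormedSpace ℝ E']

/-- The second derivative of a composition at a critical point. -/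
lemma iteratedFDeriv_two_comp_of_fderiv_eq_zero {h : E' → ℝ} {φ : E → E'} {y : E}
    (hh : ContDiffAt ℝ 2 h (φ y)) (hφ : ContDiffAt ℝ 2 φ y) (h0 : fderiv ℝ h (φ y) = 0)
    (v w : E) : iteratedFDeriv ℝ 2 (h ∘ φ) y ![v, w] =
      iteratedFDeriv ℝ 2 h (φ y) ![fderiv ℝ φ y v, fderiv ℝ φ y w] := by
  have e1 : fderiv ℝ (h ∘ φ) =ᶠ[𝓝 y] fun z => (fderiv ℝ h (φ z)).comp (fderiv ℝ φ z) := by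
    have A := hφ.eventually (by simp)
    have B := hφ.continuousAt.eventually (hh.eventually (by simp))
    filter_upwards [A, B] with z hz1 hz2
    exact fderiv_comp z (hz2.differentiableAt (by simp)) (hz1.differentiableAt (by simp))
  have d1 : DifferentiableAt ℝ (fderiv ℝ h) (φ y) :=
    (hh.fderiv_right (m := 1) (by norm_num)).differentiableAt (by simp)
  have d2 : DifferentiableAt ℝ (fderiv ℝ φ) y :=
    (hφ.fderiv_right (m := 1) (by norm_num)).differentiableAt (by simp)
  have d3 : HasFDerivAt φ (fderiv ℝ φ y) y := (hφ.differentiableAt (by simp)).hasFDerivAt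
  have d4 := (d1.hasFDerivAt.comp y d3).clm_comp d2.hasFDerivAt
  rw [iteratedFDeriv_two_apply, iteratedFDeriv_two_apply, e1.fderiv_eq]
  rw [show fderiv ℝ (fun z => (fderiv ℝ h (φ z)).comp (fderiv ℝ φ z)) y = _ from d4.fderiv]
  simp [h0]

variable {d : ℕ} {h : EuclideanSpace ℝ (Fin d) → ℝ} {y : EuclideanSpace ℝ (Fin d)}

lemma hessMat_mulVec (v : Fin d → ℝ) (i : Fin d) :
    (hessMat h y).mulVec v i =
      iteratedFDeriv ℝ 2 h y ![EuclideanSpace.single i 1, WithLp.toLp 2 v] := by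
  have hv : WithLp.toLp 2 v = ∑ j, v j • EuclideanSpace.single j (1 : ℝ) := by
    ext i; simp [Finset.sum_apply, Pi.single_apply]
  rw [hv]
  simp [Matrix.mulVec, dotProduct, hessMat, iteratedFDeriv_two_apply, mul_comm]

/-- A basis-free form of nondegeneracy: the matrix represents the second derivative in the standard
basis, so its kernel is the radical of that bilinear form. -/
lemma det_hessMat_ne_zero_iff : (hessMat h y).det ≠ 0 ↔
    ∀ v, (∀ w, iteratedFDeriv ℝ 2 h y ![w, v] = 0) → v = 0 := by
  rw [ne_eq, ← Matrix.exists_mulVec_eq_zero_iff]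
  push Not
  constructor
  · intro H v hv
    by_contra hne
    refine H (WithLp.ofLp v) (by simpa using hne) ?_
    ext i
    rw [hessMat_mulVec]
    exact hv _
  · intro H v hne hv
    refine hne ?_
    have := H (WithLp.toLp 2 v) ?_
    · simpa using this
    · intro w
      have hw : w = ∑ j, w j • EuclideanSpace.single j (1 : ℝ) := by
        ext i; simp [Finset.sum_apply, Pi.single_apply]
      have hi : ∀ i, iteratedFDeriv ℝ 2 h y
          ![EuclideanSpace.single i 1, WithLp.toLp 2 v] = 0 := fun i => by
        rw [← hessMat_mulVec, hv]; rfl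
      simp only [iteratedFDeriv_two_apply, Matrix.cons_val_zero, Matrix.cons_val_one] at hi ⊢
      rw [hw]
      simp [hi]

lemma det_hessMat_ne_zero_of_pos (H : ∀ v ≠ 0, 0 < iteratedFDeriv ℝ 2 h y ![v, v]) :
    (hessMat h y).det ≠ 0 := by
  rw [det_hessMat_ne_zero_iff]
  intro v hv
  by_contra hne
  exact (H v hne).ne' (hv v)

/-- The Morse property at a point does not depend on the coordinates. -/
lemma MorseAt.comp {φ ψ : EuclideanSpace ℝ (Fin d) → EuclideanSpace ℝ (Fin d)}
    (H : MorseAt h (φ y)) (hh : ContDiffAt ℝ 2 h (φ y)) (hφ : ContDiffAt ℝ 2 φ y)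
    (hψ : ContDiffAt ℝ 2 ψ (φ y)) (hψφ : ψ ∘ φ =ᶠ[𝓝 y] id)
    (hφψ : φ ∘ ψ =ᶠ[𝓝 (φ y)] id) : MorseAt (h ∘ φ) y := by
  intro hc
  have dφ := hφ.differentiableAt (by simp)
  have dψ := hψ.differentiableAt (by simp)
  -- The derivatives of φ and ψ are mutually inverse. Hence h is critical at φ y, and the Hessian of
  -- h ∘ φ is that of h pulled back by an isomorphism.
  have e1 : (fderiv ℝ ψ (φ y)).comp (fderiv ℝ φ y) = ContinuousLinearMap.id ℝ _ := by
    rw [← fderiv_comp y dψ dφ, hψφ.fderiv_eq, fderiv_id]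
  have hy : ψ (φ y) = y := hψφ.self_of_nhds
  have e2 : (fderiv ℝ φ y).comp (fderiv ℝ ψ (φ y)) = ContinuousLinearMap.id ℝ _ := by
    have := fderiv_comp (φ y) (by rw [hy]; exact dφ) dψ
    rw [hφψ.fderiv_eq, fderiv_id, hy] at this
    exact this.symm
  have h0 : fderiv ℝ h (φ y) = 0 := by
    have := fderiv_comp y (hh.differentiableAt (by simp)) dφ
    rw [hc] at this
    calc fderiv ℝ h (φ y) =
        ((fderiv ℝ h (φ y)).comp (fderiv ℝ φ y)).comp (fderiv ℝ ψ (φ y)) := by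
          rw [ContinuousLinearMap.comp_assoc, e2, ContinuousLinearMap.comp_id]
      _ = 0 := by rw [← this, ContinuousLinearMap.zero_comp]
  have H' := H h0
  rw [det_hessMat_ne_zero_iff] at H' ⊢
  intro v hv
  have := H' (fderiv ℝ φ y v) fun w => by
    have := hv (fderiv ℝ ψ (φ y) w)
    rw [iteratedFDeriv_two_comp_of_fderiv_eq_zero hh hφ h0] at this
    have e3 : fderiv ℝ φ y (fderiv ℝ ψ (φ y) w) = w := DFunLike.congr_fun e2 w
    rwa [e3] at this
  have e3 : fderiv ℝ ψ (φ y) (fderiv ℝ φ y v) = v := DFunLike.congr_fun e1 v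
  rw [← e3, this, map_zero]

end Hessian

/-! ### Null sets of bad parameters -/

section Measure

open MeasureTheory

/-- A matrix pencil `A + s • B` with `B` nonsingular is singular for finitely many `s` only. -/
lemma finite_setOf_det_add_smul_eq_zero {m : ℕ} (A B : Matrix (Fin m) (Fin m) ℝ)
    (hB : B.det ≠ 0) : {s : ℝ | (A + s • B).det = 0}.Finite := by
  have hne : (B⁻¹ * A * (-1 : Matrix (Fin m) (Fin m) ℝ)).charpoly ≠ 0 :=
    (Matrix.charpoly_monic _).ne_zero
  refine (Polynomial.finite_setOfPred_isRoot hne).subset fun s hs => ?_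
  have hu : IsUnit B.det := isUnit_iff_ne_zero.2 hB
  -- Up to the factor det B, the determinant is the characteristic polynomial of -B⁻¹A at s.
  have e : A + s • B = B * (Matrix.scalar (Fin m) s - B⁻¹ * A * (-1)) := by
    rw [mul_sub, ← mul_assoc, ← mul_assoc, Matrix.mul_nonsing_inv _ hu]
    simp [add_comm, ← Matrix.smul_eq_mul_diagonal]
  have hs' : (A + s • B).det = 0 := hs
  rw [e, Matrix.det_mul] at hs'
  have := (mul_eq_zero.1 hs').resolve_left hB
  simpa [Polynomial.IsRoot, Matrix.eval_charpoly] using this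

/-- For almost all parameters `(t, s)`, the matrix pencil `A + s • B` is nonsingular at the
solutions of `t = a + s • b`. -/
lemma ae_forall_eq_det_ne_zero {r m : ℕ} {U : Set (EuclideanSpace ℝ (Fin r))} (hU : IsOpen U)
    {a b : EuclideanSpace ℝ (Fin r) → EuclideanSpace ℝ (Fin r)}
    (ha : DifferentiableOn ℝ a U) (hb : DifferentiableOn ℝ b U)
    {A B : EuclideanSpace ℝ (Fin r) → Matrix (Fin m) (Fin m) ℝ}
    (hA : ContinuousOn A U) (hB : ContinuousOn B U) (hBdet : ∀ y ∈ U, (B y).det ≠ 0) :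
    ∀ᵐ p : EuclideanSpace ℝ (Fin r) × ℝ, ∀ y ∈ U, p.1 = a y + p.2 • b y →
      (A y + p.2 • B y).det ≠ 0 := by
  set S : Set (EuclideanSpace ℝ (Fin r) × ℝ) :=
    {p | p.1 ∈ U ∧ (A p.1 + p.2 • B p.1).det = 0} with hS
  have hcont : ContinuousOn (fun p : EuclideanSpace ℝ (Fin r) × ℝ =>
      (A p.1 + p.2 • B p.1).det) (U ×ˢ Set.univ) := by
    have h1 : ContinuousOn (fun p : EuclideanSpace ℝ (Fin r) × ℝ => A p.1) (U ×ˢ Set.univ) :=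
      hA.comp continuousOn_fst fun p hp => hp.1
    have h2 : ContinuousOn (fun p : EuclideanSpace ℝ (Fin r) × ℝ => B p.1) (U ×ˢ Set.univ) :=
      hB.comp continuousOn_fst fun p hp => hp.1
    exact (continuous_id.matrix_det).comp_continuousOn (h1.add (continuousOn_snd.smul h2))
  have hSm : MeasurableSet S := by
    have hW : IsOpen (U ×ˢ (Set.univ : Set ℝ)) := hU.prod isOpen_univ
    have := hcont.isOpen_inter_preimage hW (isOpen_compl_singleton (x := (0 : ℝ)))
    have e : S = (U ×ˢ Set.univ) \ ((U ×ˢ Set.univ) ∩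
        (fun p : EuclideanSpace ℝ (Fin r) × ℝ => (A p.1 + p.2 • B p.1).det) ⁻¹' {0}ᶜ) := by
      ext p
      simp only [hS, Set.mem_ofPred_eq, Set.mem_sdiff, Set.mem_prod, Set.mem_univ, and_true,
        Set.mem_inter_iff, Set.mem_preimage, Set.mem_compl_iff, Set.mem_singleton_iff]
      tauto
    rw [e]
    exact MeasurableSet.diff hW.measurableSet this.measurableSet
  -- Fubini: over each y only finitely many s are bad.
  have hS0 : (volume : Measure (EuclideanSpace ℝ (Fin r) × ℝ)) S = 0 := by
    rw [Measure.volume_eq_prod, Measure.measure_prod_null hSm]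
    refine Filter.Eventually.of_forall fun y => ?_
    by_cases hy : y ∈ U
    · exact ((finite_setOf_det_add_smul_eq_zero (A y) (B y) (hBdet y hy)).subset
        fun s hs => hs.2).measure_zero _
    · have : Prod.mk y ⁻¹' S = ∅ := by
        ext s; simp [hS, hy]
      simp [this]
  -- Keeping s as second component gives a map between spaces of equal dimension r + 1, so
  -- differentiability suffices for the image of the null set `S` to be null.
  have hd : DifferentiableOn ℝ
      (fun p : EuclideanSpace ℝ (Fin r) × ℝ => (a p.1 + p.2 • b p.1, p.2)) S := by
    have h1 : DifferentiableOn ℝ (fun p : EuclideanSpace ℝ (Fin r) × ℝ => a p.1) S :=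
      ha.comp differentiableOn_fst fun p hp => hp.1
    have h2 : DifferentiableOn ℝ (fun p : EuclideanSpace ℝ (Fin r) × ℝ => b p.1) S :=
      hb.comp differentiableOn_fst fun p hp => hp.1
    exact (h1.add (differentiableOn_snd.smul h2)).prodMk differentiableOn_snd
  have : (volume : Measure (EuclideanSpace ℝ (Fin r) × ℝ)).IsAddHaarMeasure := by
    rw [Measure.volume_eq_prod]; infer_instance
  have := addHaar_image_eq_zero_of_differentiableOn_of_addHaar_eq_zero volume hd hS0
  filter_upwards [measure_eq_zero_iff_ae_notMem.1 this] with p hp y hy he h0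
  exact hp ⟨(y, p.2), ⟨hy, h0⟩, by simp [← he]⟩

end Measure

/-! ### From local to global genericity -/

section Topological

variable {𝓕 X : Type*} [TopologicalSpace 𝓕] [TopologicalSpace X] {P : Set (𝓕 × X)}

lemma isOpen_setOf_forall_mem (hP : IsOpen P) {K : Set X} (hK : IsCompact K) :
    IsOpen {F : 𝓕 | ∀ u ∈ K, (F, u) ∈ P} := by
  rw [isOpen_iff_mem_nhds]
  intro F hF
  exact hK.eventually_forall_of_forall_eventually (P := fun F u => (F, u) ∈ P)
    fun u hu => hP.mem_nhds (hF u hu)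

/-- Compactness of K leaves finitely many dense conditions, which are also open; no Baire argument
is needed. -/
lemma dense_setOf_forall_mem_of_local [T2Space X] [CompactSpace X] (hP : IsOpen P) {K : Set X}
    (hK : IsCompact K)
    (h : ∀ x ∈ K, ∃ V ∈ 𝓝 x, Dense {F : 𝓕 | ∀ u ∈ V ∩ K, (F, u) ∈ P}) :
    Dense {F : 𝓕 | ∀ u ∈ K, (F, u) ∈ P} := by
  have key : Dense {F : 𝓕 | ∀ u ∈ closure K ∩ K, (F, u) ∈ P} := by
    -- With closures the sets `closure s ∩ K` are compact, so the conditions are open and density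
    -- passes to unions.
    refine hK.induction_on (p := fun s => Dense {F : 𝓕 | ∀ u ∈ closure s ∩ K, (F, u) ∈ P})
      (by simp) (fun s t hst ht => ht.mono (by exact fun F hF u hu => hF u ⟨closure_mono hst hu.1, hu.2⟩))
      (fun s t hs ht => ?_) (fun x hx => ?_)
    · have := hs.inter_of_isOpen_left ht
        (isOpen_setOf_forall_mem hP (hK.inter_left isClosed_closure))
      refine this.mono fun F hF u hu => ?_
      rw [closure_union] at hu
      rcases hu.1 with h1 | h1
      · exact hF.1 u ⟨h1, hu.2⟩
      · exact hF.2 u ⟨h1, hu.2⟩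
    · obtain ⟨V, hV, hd⟩ := h x hx
      obtain ⟨C, hC, hCc, hCV⟩ := exists_mem_nhds_isClosed_subset hV
      refine ⟨C, mem_nhdsWithin_of_mem_nhds hC, hd.mono
        (by exact fun F hF u hu => hF u ⟨hCV (hCc.closure_eq ▸ hu.1), hu.2⟩)⟩
  exact key.mono (by exact fun F hF u hu => hF u ⟨subset_closure hu, hu⟩)

/-- An open condition which is locally generic along a closed set `Z` and locally generic near the
points of the complement of `Z` is generic. -/
theorem isOpen_and_dense_setOf_forall_mem [T2Space X] [CompactSpace X] (hP : IsOpen P)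
    {Z : Set X} (hZ : IsClosed Z)
    (h1 : ∀ z ∈ Z, ∃ V ∈ 𝓝 z, Dense {F : 𝓕 | ∀ u ∈ V ∩ Z, (F, u) ∈ P})
    (h2 : ∀ x ∉ Z, ∃ V ∈ 𝓝 x, Dense {F : 𝓕 | ∀ u ∈ V, (F, u) ∈ P}) :
    IsOpen {F : 𝓕 | ∀ u, (F, u) ∈ P} ∧ Dense {F : 𝓕 | ∀ u, (F, u) ∈ P} := by
  refine ⟨by simpa using isOpen_setOf_forall_mem hP isCompact_univ, ?_⟩
  rw [dense_iff_inter_open]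
  intro O hO hne
  obtain ⟨F₁, hF₁O, hF₁⟩ := (dense_setOf_forall_mem_of_local hP hZ.isCompact h1).inter_open_nonempty
    O hO hne
  -- Goodness along Z spreads to a neighbourhood; an open C ⊇ Z with good closure leaves `Cᶜ`
  -- compact and disjoint from Z.
  have hW : {u | (F₁, u) ∈ P} ∈ 𝓝ˢ Z := by
    refine IsOpen.mem_nhdsSet (hP.preimage (by fun_prop : Continuous fun u => (F₁, u))) |>.2 ?_
    exact hF₁
  obtain ⟨C, hC, hCc, hCW⟩ := (hasBasis_nhdsSet Z |>.mem_iff.1 hW).elim fun W hW' =>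
    (normal_exists_closure_subset hZ hW'.1.1 hW'.1.2).elim fun C hC =>
      (⟨C, hC.2.1, hC.1, hC.2.2.trans hW'.2⟩ : ∃ C, Z ⊆ C ∧ IsOpen C ∧
        closure C ⊆ {u | (F₁, u) ∈ P})
  have d2 : Dense {F : 𝓕 | ∀ u ∈ Cᶜ, (F, u) ∈ P} := by
    refine dense_setOf_forall_mem_of_local hP hCc.isClosed_compl.isCompact fun x hx => ?_
    obtain ⟨V, hV, hd⟩ := h2 x fun hxZ => hx (hC hxZ)
    exact ⟨V, hV, hd.mono (by exact fun F hF u hu => hF u hu.1)⟩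
  obtain ⟨F, hF, hF2⟩ := d2.inter_open_nonempty _
    (hO.inter (isOpen_setOf_forall_mem hP (isClosed_closure (s := C)).isCompact)) ⟨F₁, hF₁O, hCW⟩
  refine ⟨F, hF.1, fun u => ?_⟩
  by_cases hu : u ∈ C
  · exact hF.2 u (subset_closure hu)
  · exact hF2 u hu

end Topological

/-! ### Invariant functions and the C^N topology -/

section Space

variable {d : ℕ} {X : Type*} [TopologicalSpace X] [ChartedSpace (EuclideanSpace ℝ (Fin d)) X]
  {N : ℕ} {τ : X → X}

lemma contDiffOn_comp_symm [IsManifold (𝓡 d) ∞ X] {F : X → ℝ} {n : ℕ}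
    (hF : ContMDiff (𝓡 d) 𝓘(ℝ, ℝ) n F)
    {e : OpenPartialHomeomorph X (EuclideanSpace ℝ (Fin d))}
    (he : e ∈ IsManifold.maximalAtlas (𝓡 d) ∞ X) : ContDiffOn ℝ n (F ∘ e.symm) e.target := by
  rw [← contMDiffOn_iff_contDiffOn]
  exact hF.comp_contMDiffOn ((contMDiffOn_symm_of_mem_maximalAtlas he).of_le
    (by exact_mod_cast le_top))

/-- The linear perturbation `F + ∑ i, c i * G i` of an invariant function. -/
noncomputable def perturb {κ : Type*} [Fintype κ] (F : InvariantCN d τ N) (G : κ → InvariantCN d τ N)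
    (c : κ → ℝ) : InvariantCN d τ N :=
  ⟨⟨fun u => F.1 u + ∑ i, c i * (G i).1 u,
    F.1.contMDiff.add (contMDiff_finsetSum fun i _ => contMDiff_const.mul (G i).1.contMDiff)⟩,
    fun u => by
      change F.1 (τ u) + ∑ i, c i * (G i).1 (τ u) = F.1 u + ∑ i, c i * (G i).1 u
      simp only [F.2, (G _).2]⟩

lemma perturb_apply {κ : Type*} [Fintype κ] (F : InvariantCN d τ N) (G : κ → InvariantCN d τ N)
    (c : κ → ℝ) (u : X) : (perturb F G c).1 u = F.1 u + ∑ i, c i * (G i).1 u := rfl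

lemma perturb_zero {κ : Type*} [Fintype κ] (F : InvariantCN d τ N) (G : κ → InvariantCN d τ N) :
    perturb F G 0 = F := by
  apply Subtype.ext
  ext u
  rw [perturb_apply]
  simp

lemma iteratedFDeriv_add_sum {E κ : Type*} [NormedAddCommGroup E] [NormedSpace ℝ E] [Fintype κ]
    {f : E → ℝ} {g : κ → E → ℝ} {c : κ → ℝ} {j : ℕ} {y : E} (hf : ContDiffAt ℝ j f y)
    (hg : ∀ i, ContDiffAt ℝ j (g i) y) :
    iteratedFDeriv ℝ j (fun z => f z + ∑ i, c i * g i z) y =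
      iteratedFDeriv ℝ j f y + ∑ i, c i • iteratedFDeriv ℝ j (g i) y := by
  have h1 : ∀ i, ContDiffAt ℝ j (fun z => c i • g i z) y := fun i => (hg i).const_smul (c i)
  have e : (fun z => f z + ∑ i, c i * g i z) = f + ∑ i, c i • g i := by
    ext z; simp
  have h2 : ContDiffAt ℝ j (∑ i, c i • g i) y := by
    have := ContDiffAt.sum (s := Finset.univ) fun i _ => h1 i
    convert this using 1
    ext z; simp
  rw [e, iteratedFDeriv_add_apply hf h2]
  congr 1
  have := iteratedFDeriv_sum_apply (𝕜 := ℝ) (f := fun i => c i • g i) (u := Finset.univ) (n := j)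
    (x := y) fun i _ => h1 i
  rw [this]
  exact Finset.sum_congr rfl fun i _ => iteratedFDeriv_const_smul_apply (hg i)

/-- Perturbations depend continuously on the coefficients. -/
lemma continuous_perturb [IsManifold (𝓡 d) ∞ X] {κ : Type*} [Fintype κ] (F : InvariantCN d τ N)
    (G : κ → InvariantCN d τ N) : Continuous (perturb F G) := by
  refine continuous_induced_rng.2 (continuous_iInf_rng.2 fun e => continuous_iInf_rng.2 fun he =>
    continuous_iInf_rng.2 fun j => continuous_iInf_rng.2 fun hj => continuous_induced_rng.2 ?_)
  rw [continuous_iff_continuousAt]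
  intro c₀
  rw [ContinuousAt, UniformOnFun.tendsto_iff_tendstoUniformlyOn]
  rintro K ⟨hK, hKe⟩
  have hjN : (j : WithTop ℕ∞) ≤ N := by exact_mod_cast (Set.mem_Iic.1 hj)
  have hcd : ∀ H : InvariantCN d τ N, ContDiffOn ℝ j (H.1 ∘ e.symm) e.target := fun H =>
    (contDiffOn_comp_symm H.1.contMDiff he).of_le hjN
  have hca : ∀ H : InvariantCN d τ N, ∀ y ∈ K, ContDiffAt ℝ j (H.1 ∘ e.symm) y := fun H y hy =>
    (hcd H).contDiffAt (e.open_target.mem_nhds (hKe hy))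
  have hcont : ∀ H : InvariantCN d τ N, ContinuousOn (iteratedFDeriv ℝ j (H.1 ∘ e.symm)) K :=
    fun H y hy => ((hca H y hy).continuousAt_iteratedFDeriv le_rfl).continuousWithinAt
  have hform : ∀ c, ∀ y ∈ K, iteratedFDeriv ℝ j ((perturb F G c).1 ∘ e.symm) y =
      iteratedFDeriv ℝ j (F.1 ∘ e.symm) y +
        ∑ i, c i • iteratedFDeriv ℝ j ((G i).1 ∘ e.symm) y := fun c y hy =>
    iteratedFDeriv_add_sum (hca F y hy) fun i => hca (G i) y hy
  -- The derivative is affine in c with coefficients continuous in y; joint continuity and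
  -- compactness of K give uniform convergence on K.
  have hjoint : ContinuousOn (Function.uncurry fun (c : κ → ℝ) y =>
      iteratedFDeriv ℝ j ((perturb F G c).1 ∘ e.symm) y) (Set.univ ×ˢ K) := by
    have : ContinuousOn (fun p : (κ → ℝ) × EuclideanSpace ℝ (Fin d) =>
        iteratedFDeriv ℝ j (F.1 ∘ e.symm) p.2 +
          ∑ i, p.1 i • iteratedFDeriv ℝ j ((G i).1 ∘ e.symm) p.2) (Set.univ ×ˢ K) := by
      refine ((hcont F).comp continuousOn_snd fun p hp => hp.2).add
        (continuousOn_finsetSum _ fun i _ => ContinuousOn.smul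
          ((continuous_apply i).comp continuous_fst).continuousOn
          ((hcont (G i)).comp continuousOn_snd fun p hp => hp.2))
    exact this.congr fun p hp => hform p.1 p.2 hp.2
  rw [tendstoUniformlyOn_iff_tendstoUniformly_comp_coe]
  have : CompactSpace K := isCompact_iff_compactSpace.1 hK
  refine ContinuousOn.tendstoUniformly (U := Set.univ)
    (f := fun (c : κ → ℝ) (y : K) => iteratedFDeriv ℝ j ((perturb F G c).1 ∘ e.symm) y)
    Filter.univ_mem ?_
  exact ContinuousOn.comp (g := Function.uncurry fun (c : κ → ℝ) y =>
      iteratedFDeriv ℝ j ((perturb F G c).1 ∘ e.symm) y)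
    (f := fun p : (κ → ℝ) × K => (p.1, (p.2 : EuclideanSpace ℝ (Fin d)))) hjoint
    (by fun_prop) fun p _ => ⟨Set.mem_univ _, p.2.2⟩

/-- The derivatives of an invariant function in a chart depend continuously on the function and
on the point. -/
lemma continuousAt_iteratedFDeriv_chart [IsManifold (𝓡 d) ∞ X]
    {e : OpenPartialHomeomorph X (EuclideanSpace ℝ (Fin d))}
    (he : e ∈ IsManifold.maximalAtlas (𝓡 d) ∞ X) {j : ℕ} (hj : j ≤ N) (F : InvariantCN d τ N)
    {y : EuclideanSpace ℝ (Fin d)} (hy : y ∈ e.target) :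
    ContinuousAt (fun p : InvariantCN d τ N × EuclideanSpace ℝ (Fin d) =>
      iteratedFDeriv ℝ j (p.1.1 ∘ e.symm) p.2) (F, y) := by
  have hc : Continuous fun F : InvariantCN d τ N =>
      UniformOnFun.ofFun {K : Set (EuclideanSpace ℝ (Fin d)) | IsCompact K ∧ K ⊆ e.target}
        (iteratedFDeriv ℝ j (F.1 ∘ e.symm)) := by
    let _ := cNTopology d X N
    refine Continuous.comp (g := fun F : C^N⟮𝓡 d, X; 𝓘(ℝ, ℝ), ℝ⟯ => UniformOnFun.ofFun
      {K : Set (EuclideanSpace ℝ (Fin d)) | IsCompact K ∧ K ⊆ e.target}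
        (iteratedFDeriv ℝ j (F ∘ e.symm))) (f := fun F : InvariantCN d τ N => F.1) ?_ continuous_induced_dom
    exact continuous_iInf_dom (i := e) (continuous_iInf_dom (i := he) (continuous_iInf_dom (i := j)
      (continuous_iInf_dom (i := Set.mem_Iic.2 hj) continuous_induced_dom)))
  have h1 := UniformOnFun.continuousAt_eval₂
    (f := UniformOnFun.ofFun {K : Set (EuclideanSpace ℝ (Fin d)) | IsCompact K ∧ K ⊆ e.target}
        (iteratedFDeriv ℝ j (F.1 ∘ e.symm))) (x := y) ?_ ?_
  · exact ContinuousAt.comp (f := fun p : InvariantCN d τ N × EuclideanSpace ℝ (Fin d) =>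
      (UniformOnFun.ofFun {K : Set (EuclideanSpace ℝ (Fin d)) | IsCompact K ∧ K ⊆ e.target}
        (iteratedFDeriv ℝ j (p.1.1 ∘ e.symm)), p.2)) (x := (F, y)) h1
      ((hc.comp continuous_fst).prodMk continuous_snd).continuousAt
  · obtain ⟨K, hK, hKe, hKc⟩ := local_compact_nhds (e.open_target.mem_nhds hy)
    exact ⟨K, ⟨hKc, hKe⟩, hK⟩
  · exact (((contDiffOn_comp_symm F.1.contMDiff he).contDiffAt
      (e.open_target.mem_nhds hy)).continuousAt_iteratedFDeriv (by exact_mod_cast hj))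

end Space

lemma two_le_infty : (2 : WithTop ℕ∞) ≤ ∞ := by
  exact WithTop.coe_le_coe.2 (le_top : (2 : ℕ∞) ≤ ⊤)

/-! ### Independence of the chart -/

section Charts

variable {d : ℕ} {X : Type*} [TopologicalSpace X] [ChartedSpace (EuclideanSpace ℝ (Fin d)) X]
  [IsManifold (𝓡 d) ∞ X] {g : X → ℝ} {x : X}
  {e e' : OpenPartialHomeomorph X (EuclideanSpace ℝ (Fin d))}

lemma contDiffAt_comp_symm {n : ℕ} (hg : ContMDiff (𝓡 d) 𝓘(ℝ, ℝ) n g)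
    (he : e ∈ IsManifold.maximalAtlas (𝓡 d) ∞ X) {y : EuclideanSpace ℝ (Fin d)}
    (hy : y ∈ e.target) : ContDiffAt ℝ n (g ∘ e.symm) y :=
  (contDiffOn_comp_symm hg he).contDiffAt (e.open_target.mem_nhds hy)

omit [IsManifold (𝓡 d) ∞ X] in
/-- Critical points can be tested in any chart. -/
lemma isCriticalPoint_iff (hg : ContMDiff (𝓡 d) 𝓘(ℝ, ℝ) 1 g)
    (he : e ∈ IsManifold.maximalAtlas (𝓡 d) ∞ X) (hx : x ∈ e.source) :
    IsCriticalPoint d g x ↔ fderiv ℝ (g ∘ e.symm) (e x) = 0 := by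
  have he1 : e ∈ IsManifold.maximalAtlas (𝓡 d) 1 X :=
    IsManifold.maximalAtlas_subset_of_le (by simp) he
  have hgx : MDifferentiableAt (𝓡 d) 𝓘(ℝ, ℝ) g x := (hg x).mdifferentiableAt (by simp)
  have h1 : MDifferentiableAt (𝓡 d) (𝓡 d) e x := mdifferentiableAt_of_mem_maximalAtlas he1 hx
  have h2 : MDifferentiableAt (𝓡 d) (𝓡 d) e.symm (e x) :=
    mdifferentiableAt_symm_of_mem_maximalAtlas he1 (e.map_source hx)
  have hge : MDifferentiableAt (𝓡 d) 𝓘(ℝ, ℝ) (g ∘ e.symm) (e x) :=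
    MDifferentiableAt.comp (I' := 𝓡 d) (e x) (by rw [e.left_inv hx]; exact hgx) h2
  unfold IsCriticalPoint
  rw [← mfderiv_eq_fderiv]
  constructor
  · intro h
    rw [mfderiv_comp (I' := 𝓡 d) (e x) (by rw [e.left_inv hx]; exact hgx) h2]
    rw [e.left_inv hx, h]
    exact ContinuousLinearMap.zero_comp _
  · intro h
    have : g =ᶠ[𝓝 x] (g ∘ e.symm) ∘ e := by
      filter_upwards [e.open_source.mem_nhds hx] with z hz
      simp [e.left_inv hz]
    rw [this.mfderiv_eq, mfderiv_comp (I' := 𝓡 d) x hge h1, h]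
    exact ContinuousLinearMap.zero_comp _

lemma hessMat_congr {h h' : EuclideanSpace ℝ (Fin d) → ℝ} {y : EuclideanSpace ℝ (Fin d)}
    (hh : h =ᶠ[𝓝 y] h') : hessMat h y = hessMat h' y := by
  simp only [hessMat, (hh.iteratedFDeriv ℝ 2).eq_of_nhds]

lemma MorseAt.congr {h h' : EuclideanSpace ℝ (Fin d) → ℝ} {y : EuclideanSpace ℝ (Fin d)}
    (H : MorseAt h y) (hh : h =ᶠ[𝓝 y] h') : MorseAt h' y := by
  rw [MorseAt, ← hessMat_congr hh, ← hh.fderiv_eq]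
  exact H

omit [IsManifold (𝓡 d) ∞ X] in
lemma contDiffAt_chart_comp_symm (he : e ∈ IsManifold.maximalAtlas (𝓡 d) ∞ X)
    (he' : e' ∈ IsManifold.maximalAtlas (𝓡 d) ∞ X) (hx : x ∈ e.source) (hx' : x ∈ e'.source) :
    ContDiffAt ℝ ∞ (e' ∘ e.symm) (e x) := by
  rw [← contMDiffAt_iff_contDiffAt]
  refine ContMDiffAt.comp (I' := 𝓡 d) (e x) ?_
    (contMDiffAt_symm_of_mem_maximalAtlas he (e.map_source hx))
  rw [e.left_inv hx]
  exact contMDiffAt_of_mem_maximalAtlas he' hx'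

lemma MorseAt.change_chart (hg : ContMDiff (𝓡 d) 𝓘(ℝ, ℝ) 2 g)
    (he : e ∈ IsManifold.maximalAtlas (𝓡 d) ∞ X) (he' : e' ∈ IsManifold.maximalAtlas (𝓡 d) ∞ X)
    (hx : x ∈ e.source) (hx' : x ∈ e'.source) (H : MorseAt (g ∘ e'.symm) (e' x)) :
    MorseAt (g ∘ e.symm) (e x) := by
  have inv : ∀ {a b : OpenPartialHomeomorph X (EuclideanSpace ℝ (Fin d))}, x ∈ a.source →
      x ∈ b.source → ∀ᶠ y in 𝓝 (a x), a.symm y ∈ b.source ∧ y ∈ a.target := fun {a b} ha hb => by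
    refine ((a.continuousAt_symm (a.map_source ha)).eventually_mem ?_).and
      (a.open_target.mem_nhds (a.map_source ha))
    rw [a.left_inv ha]
    exact b.open_source.mem_nhds hb
  have hφ : (e' ∘ e.symm) (e x) = e' x := by simp [e.left_inv hx]
  have := MorseAt.comp (h := g ∘ e'.symm) (φ := e' ∘ e.symm) (ψ := e ∘ e'.symm) (y := e x)
    (by rwa [hφ]) (by rw [hφ]; exact contDiffAt_comp_symm (n := 2) hg he' (e'.map_source hx'))
    ((contDiffAt_chart_comp_symm he he' hx hx').of_le two_le_infty)
    (by rw [hφ]; exact (contDiffAt_chart_comp_symm he' he hx' hx).of_le two_le_infty)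
    ?_ ?_
  · refine this.congr ?_
    filter_upwards [inv hx hx'] with y hy
    simp [e'.left_inv hy.1]
  · filter_upwards [inv hx hx'] with y hy
    simp [e'.left_inv hy.1, e.right_inv hy.2]
  · rw [hφ]
    filter_upwards [inv hx' hx] with y hy
    simp [e.left_inv hy.1, e'.right_inv hy.2]

/-- The Morse condition at a point can be tested in any chart. -/
lemma morse_condition_iff (hg : ContMDiff (𝓡 d) 𝓘(ℝ, ℝ) 2 g)
    (he : e ∈ IsManifold.maximalAtlas (𝓡 d) ∞ X) (hx : x ∈ e.source) :
    (IsCriticalPoint d g x → (hessianMatrix d g x).det ≠ 0) ↔ MorseAt (g ∘ e.symm) (e x) := by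
  have hc : chartAt (EuclideanSpace ℝ (Fin d)) x ∈ IsManifold.maximalAtlas (𝓡 d) ∞ X :=
    IsManifold.chart_mem_maximalAtlas x
  have hxc := mem_chart_source (EuclideanSpace ℝ (Fin d)) x
  rw [isCriticalPoint_iff (hg.of_le (by norm_num)) hc hxc]
  exact ⟨fun H => MorseAt.change_chart hg he hc hx hxc H,
    fun H => MorseAt.change_chart hg hc he hxc hx H⟩

end Charts

/-! ### Charts in which an immersion is linear -/

section Slice

variable {m d : ℕ} {Y : Type*} [TopologicalSpace Y] [ChartedSpace (EuclideanSpace ℝ (Fin m)) Y]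
  {X : Type*} [TopologicalSpace X] [ChartedSpace (EuclideanSpace ℝ (Fin d)) X]

/-- Charts of the source and of the target in which an immersion is linear. -/
structure SliceAt (m d : ℕ) {Y : Type*} [TopologicalSpace Y]
    [ChartedSpace (EuclideanSpace ℝ (Fin m)) Y] {X : Type*} [TopologicalSpace X]
    [ChartedSpace (EuclideanSpace ℝ (Fin d)) X] (j : Y → X) (y : Y) where
  /-- The chart of the source. -/
  dom : OpenPartialHomeomorph Y (EuclideanSpace ℝ (Fin m))
  /-- The chart of the target. -/
  cod : OpenPartialHomeomorph X (EuclideanSpace ℝ (Fin d))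
  /-- The immersion in these charts. -/
  incl : EuclideanSpace ℝ (Fin m) →L[ℝ] EuclideanSpace ℝ (Fin d)
  /-- A left inverse of the inclusion. -/
  proj : EuclideanSpace ℝ (Fin d) →L[ℝ] EuclideanSpace ℝ (Fin m)
  dom_mem : dom ∈ IsManifold.maximalAtlas (𝓡 m) ∞ Y
  cod_mem : cod ∈ IsManifold.maximalAtlas (𝓡 d) ∞ X
  mem_dom : y ∈ dom.source
  mapsTo : ∀ u ∈ dom.source, j u ∈ cod.source
  proj_incl : ∀ v, proj (incl v) = v
  eq_incl : ∀ u ∈ dom.source, cod (j u) = incl (dom u)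

lemma nonempty_sliceAt {j : Y → X} {y : Y} (h : Manifold.IsImmersionAt (𝓡 m) (𝓡 d) ∞ j y) :
    Nonempty (SliceAt m d j y) := by
  refine ⟨⟨h.domChart, h.codChart,
    h.equiv.toContinuousLinearMap.comp (ContinuousLinearMap.inl ℝ _ _),
    (ContinuousLinearMap.fst ℝ _ _).comp h.equiv.symm.toContinuousLinearMap,
    h.domChart_mem_maximalAtlas, h.codChart_mem_maximalAtlas, h.mem_domChart_source,
    h.source_subset_preimage_source, fun v => by simp, fun u hu => ?_⟩⟩
  have hu' : h.domChart u ∈ (h.domChart.extend (𝓡 m)).target := by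
    simpa using h.domChart.map_source hu
  have := h.writtenInCharts hu'
  simpa [h.domChart.left_inv hu] using this

variable {j : Y → X} {y : Y} (s : SliceAt m d j y)

lemma SliceAt.eq_incl_symm {z : EuclideanSpace ℝ (Fin m)} (hz : z ∈ s.dom.target) :
    s.cod (j (s.dom.symm z)) = s.incl z := by
  rw [s.eq_incl _ (s.dom.map_target hz), s.dom.right_inv hz]

lemma SliceAt.comp_eq {F : X → ℝ} {z : EuclideanSpace ℝ (Fin m)} (hz : z ∈ s.dom.target) :
    F (j (s.dom.symm z)) = F (s.cod.symm (s.incl z)) := by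
  rw [← s.eq_incl_symm hz, s.cod.left_inv (s.mapsTo _ (s.dom.map_target hz))]

lemma SliceAt.incl_mem {z : EuclideanSpace ℝ (Fin m)} (hz : z ∈ s.dom.target) :
    s.incl z ∈ s.cod.target := by
  rw [← s.eq_incl_symm hz]
  exact s.cod.map_source (s.mapsTo _ (s.dom.map_target hz))

lemma SliceAt.comp_eventuallyEq {F : X → ℝ} {z : EuclideanSpace ℝ (Fin m)}
    (hz : z ∈ s.dom.target) :
    (F ∘ j) ∘ s.dom.symm =ᶠ[𝓝 z] (F ∘ s.cod.symm) ∘ s.incl := by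
  filter_upwards [s.dom.open_target.mem_nhds hz] with w hw
  exact s.comp_eq hw

end Slice

lemma iteratedFDeriv_comp_continuousLinearMap {E E' : Type*} [NormedAddCommGroup E]
    [NormedSpace ℝ E] [NormedAddCommGroup E'] [NormedSpace ℝ E'] {f : E' → ℝ} (L : E →L[ℝ] E')
    {x : E} {n : ℕ} (hf : ContDiffAt ℝ n f (L x)) (v : Fin n → E) :
    iteratedFDeriv ℝ n (f ∘ L) x v = iteratedFDeriv ℝ n f (L x) (L ∘ v) := by
  obtain ⟨u, hu, hus⟩ := (hf.eventually (by simp)).exists_mem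
  obtain ⟨t, htu, ht, hxt⟩ := mem_nhds_iff.1 hu
  have hft : ContDiffOn ℝ n f t := fun y hy => (hus y (htu hy)).contDiffWithinAt
  have hLt : IsOpen (L ⁻¹' t) := ht.preimage L.continuous
  have := L.iteratedFDerivWithin_comp_right hft ht.uniqueDiffOn hLt.uniqueDiffOn hxt le_rfl
  rw [iteratedFDerivWithin_of_isOpen n hLt hxt, iteratedFDerivWithin_of_isOpen n ht hxt] at this
  rw [this]
  rfl

/-! ### Openness of the conditions -/

section Open

variable {m d N : ℕ} {Y : Type*} [TopologicalSpace Y] [ChartedSpace (EuclideanSpace ℝ (Fin m)) Y]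
  [IsManifold (𝓡 m) ∞ Y]
  {X : Type*} [TopologicalSpace X] [ChartedSpace (EuclideanSpace ℝ (Fin d)) X]
  [IsManifold (𝓡 d) ∞ X] {τ : X → X}

lemma isOpen_setOf_not_isCriticalPoint (hN : 1 ≤ N) {j : Y → X} (hj : Continuous j) :
    IsOpen {p : InvariantCN d τ N × Y | ¬ IsCriticalPoint d p.1.1 (j p.2)} := by
  rw [isOpen_iff_mem_nhds]
  rintro ⟨F, y⟩ hp
  set e := chartAt (EuclideanSpace ℝ (Fin d)) (j y)
  have he : e ∈ IsManifold.maximalAtlas (𝓡 d) ∞ X := IsManifold.chart_mem_maximalAtlas _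
  have hy : j y ∈ e.source := mem_chart_source _ _
  have key : ∀ F : InvariantCN d τ N, ∀ u : Y, j u ∈ e.source →
      (IsCriticalPoint d F.1 (j u) ↔ iteratedFDeriv ℝ 1 (F.1 ∘ e.symm) (e (j u)) = 0) := by
    intro F u hu
    rw [isCriticalPoint_iff (F.1.contMDiff.of_le (by exact_mod_cast hN)) he hu,
      ← norm_eq_zero, ← norm_iteratedFDeriv_one, norm_eq_zero]
  have hc : ContinuousAt (fun p : InvariantCN d τ N × Y =>
      iteratedFDeriv ℝ 1 (p.1.1 ∘ e.symm) (e (j p.2))) (F, y) :=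
    ContinuousAt.comp (f := fun p : InvariantCN d τ N × Y => (p.1, e (j p.2))) (x := (F, y))
      (continuousAt_iteratedFDeriv_chart he hN F (e.map_source hy))
      (continuousAt_fst.prodMk (ContinuousAt.comp (f := fun p : InvariantCN d τ N × Y => j p.2)
        (e.continuousAt hy) (hj.comp continuous_snd).continuousAt))
  have hne := hc.eventually_ne (mt (key F y hy).2 hp)
  have hs : ∀ᶠ p : InvariantCN d τ N × Y in 𝓝 (F, y), j p.2 ∈ e.source :=
    (hj.comp continuous_snd).continuousAt.eventually_mem (e.open_source.mem_nhds hy)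
  filter_upwards [hne, hs] with p h1 h2 h3
  exact h1 ((key p.1 p.2 h2).1 h3)

/-- In slice charts the derivatives of F ∘ j are those of F evaluated on included vectors, so the
topology of functions on X controls them. Near a critical point the Hessian determinant stays
nonzero; near any other point some directional derivative does. -/
lemma isOpen_setOf_morse_condition (hN : 2 ≤ N) {j : Y → X}
    (hj : Manifold.IsImmersion (𝓡 m) (𝓡 d) ∞ j) :
    IsOpen {p : InvariantCN d τ N × Y | IsCriticalPoint m (p.1.1 ∘ j) p.2 →
      (hessianMatrix m (p.1.1 ∘ j) p.2).det ≠ 0} := by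
  rw [isOpen_iff_mem_nhds]
  rintro ⟨F, y⟩ hp
  obtain ⟨s⟩ := nonempty_sliceAt (hj.isImmersionAt y)
  have hjs : ContMDiff (𝓡 m) (𝓡 d) ∞ j := hj.contMDiff
  have hC : ∀ F : InvariantCN d τ N, ContMDiff (𝓡 m) 𝓘(ℝ, ℝ) 2 (F.1 ∘ j) := fun F =>
    (F.1.contMDiff.of_le (by exact_mod_cast hN)).comp (hjs.of_le two_le_infty)
  have hcd : ∀ F : InvariantCN d τ N, ∀ u ∈ s.dom.source,
      ContDiffAt ℝ 2 (F.1 ∘ s.cod.symm) (s.incl (s.dom u)) := fun F u hu =>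
    contDiffAt_comp_symm (n := 2) (F.1.contMDiff.of_le (by exact_mod_cast hN)) s.cod_mem
      (s.incl_mem (s.dom.map_source hu))
  have h1 : ∀ F : InvariantCN d τ N, ∀ u ∈ s.dom.source, ∀ v,
      fderiv ℝ ((F.1 ∘ j) ∘ s.dom.symm) (s.dom u) v =
        iteratedFDeriv ℝ 1 (F.1 ∘ s.cod.symm) (s.incl (s.dom u)) (fun _ => s.incl v) := by
    intro F u hu v
    rw [(s.comp_eventuallyEq (s.dom.map_source hu)).fderiv_eq,
      fderiv_comp _ ((hcd F u hu).differentiableAt (by simp)) s.incl.differentiableAt]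
    simp [iteratedFDeriv_one_apply]
  have h2 : ∀ F : InvariantCN d τ N, ∀ u ∈ s.dom.source,
      hessMat ((F.1 ∘ j) ∘ s.dom.symm) (s.dom u) = Matrix.of fun i k =>
        iteratedFDeriv ℝ 2 (F.1 ∘ s.cod.symm) (s.incl (s.dom u))
          (s.incl ∘ ![EuclideanSpace.single i 1, EuclideanSpace.single k 1]) := by
    intro F u hu
    rw [hessMat_congr (s.comp_eventuallyEq (s.dom.map_source hu))]
    ext i k
    exact iteratedFDeriv_comp_continuousLinearMap s.incl (hcd F u hu) _
  have hcont : ∀ i ≤ N, ContinuousAt (fun p : InvariantCN d τ N × Y =>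
      iteratedFDeriv ℝ i (p.1.1 ∘ s.cod.symm) (s.incl (s.dom p.2))) (F, y) := by
    intro i hi
    exact ContinuousAt.comp (f := fun p : InvariantCN d τ N × Y => (p.1, s.incl (s.dom p.2)))
      (x := (F, y)) (continuousAt_iteratedFDeriv_chart s.cod_mem hi F
        (s.incl_mem (s.dom.map_source s.mem_dom)))
      (continuousAt_fst.prodMk (s.incl.continuous.continuousAt.comp
        (ContinuousAt.comp (f := fun p : InvariantCN d τ N × Y => p.2)
          (s.dom.continuousAt s.mem_dom) continuousAt_snd)))
  have hs : ∀ᶠ p : InvariantCN d τ N × Y in 𝓝 (F, y), p.2 ∈ s.dom.source :=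
    continuousAt_snd.eventually_mem (s.dom.open_source.mem_nhds s.mem_dom)
  have hp' := (morse_condition_iff (hC F) s.dom_mem s.mem_dom).1 hp
  by_cases hcrit : fderiv ℝ ((F.1 ∘ j) ∘ s.dom.symm) (s.dom y) = 0
  · have hdet := hp' hcrit
    rw [h2 F y s.mem_dom] at hdet
    have hc : ContinuousAt (fun p : InvariantCN d τ N × Y => (Matrix.of fun i k =>
        iteratedFDeriv ℝ 2 (p.1.1 ∘ s.cod.symm) (s.incl (s.dom p.2))
          (s.incl ∘ ![EuclideanSpace.single i 1, EuclideanSpace.single k 1]) :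
            Matrix (Fin m) (Fin m) ℝ).det) (F, y) := by
      refine (continuous_id.matrix_det).continuousAt.comp ?_
      refine continuousAt_pi.2 fun i => continuousAt_pi.2 fun k => ?_
      exact (continuous_eval_const _).continuousAt.comp (hcont 2 hN)
    filter_upwards [hc.eventually_ne hdet, hs] with p hp1 hp2
    refine (morse_condition_iff (hC p.1) s.dom_mem hp2).2 fun _ => ?_
    rw [h2 p.1 p.2 hp2]
    exact hp1
  · obtain ⟨v, hv⟩ : ∃ v, fderiv ℝ ((F.1 ∘ j) ∘ s.dom.symm) (s.dom y) v ≠ 0 := by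
      by_contra! H
      exact hcrit (ContinuousLinearMap.ext H)
    rw [h1 F y s.mem_dom] at hv
    have hc := (continuous_eval_const (F := ContinuousMultilinearMap ℝ _ ℝ)
      (fun _ : Fin 1 => s.incl v)).continuousAt.comp (hcont 1 (by omega))
    filter_upwards [hc.eventually_ne hv, hs] with p hp1 hp2
    refine (morse_condition_iff (hC p.1) s.dom_mem hp2).2 fun h0 => ?_
    refine absurd ?_ hp1
    simpa [h0] using (h1 p.1 p.2 hp2 v).symm

end Open

/-! ### Derivatives of squared distances -/

section SquaredDistance

variable {E E' : Type*} [NormedAddCommGroup E] [NormedSpace ℝ E]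
  [NormedAddCommGroup E'] [InnerProductSpace ℝ E']

lemma contDiff_norm_sub_sq (c : E') : ContDiff ℝ ∞ fun y : E' => ‖y - c‖ ^ 2 :=
  (contDiff_id.sub contDiff_const).norm_sq ℝ

lemma fderiv_norm_sub_sq (c : E') :
    fderiv ℝ (fun y : E' => ‖y - c‖ ^ 2) = fun y => (2 : ℝ) • innerSL ℝ (y - c) := by
  ext1 y
  have := ((hasFDerivAt_id (𝕜 := ℝ) y).sub_const c).norm_sq
  refine this.fderiv.trans ?_
  ext v
  simp [two_mul]

lemma iteratedFDeriv_two_norm_sub_sq (c y v w : E') :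
    iteratedFDeriv ℝ 2 (fun y : E' => ‖y - c‖ ^ 2) y ![v, w] = 2 * inner ℝ v w := by
  rw [iteratedFDeriv_two_apply, fderiv_norm_sub_sq]
  have : HasFDerivAt (fun y : E' => (2 : ℝ) • innerSL ℝ (y - c)) ((2 : ℝ) • innerSL ℝ) y :=
    (((2 : ℝ) • innerSL ℝ (E := E')).hasFDerivAt.comp y ((hasFDerivAt_id y).sub_const c))
  rw [this.fderiv]
  simp
  rfl

variable {Φ : E → E'} {x : E}

lemma fderiv_norm_sub_sq_comp (hΦ : DifferentiableAt ℝ Φ x) :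
    fderiv ℝ (fun z => ‖Φ z - Φ x‖ ^ 2) x = 0 := by
  have := fderiv_comp x
    ((contDiff_norm_sub_sq (Φ x)).contDiffAt (x := Φ x).differentiableAt (by simp)) hΦ
  refine this.trans ?_
  simp [fderiv_norm_sub_sq]

lemma iteratedFDeriv_two_norm_sub_sq_comp (hΦ : ContDiffAt ℝ 2 Φ x) (v : E) :
    iteratedFDeriv ℝ 2 (fun z => ‖Φ z - Φ x‖ ^ 2) x ![v, v] = 2 * ‖fderiv ℝ Φ x v‖ ^ 2 := by
  have := iteratedFDeriv_two_comp_of_fderiv_eq_zero (h := fun y => ‖y - Φ x‖ ^ 2)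
    ((contDiff_norm_sub_sq (Φ x)).contDiffAt.of_le two_le_infty) hΦ
    (by simp [fderiv_norm_sub_sq]) v v
  refine this.trans ?_
  rw [iteratedFDeriv_two_norm_sub_sq, real_inner_self_eq_norm_sq]

end SquaredDistance

/-! ### Invariant extensions by symmetrization -/

section Extension

variable {d N : ℕ} {X : Type*} [TopologicalSpace X] [ChartedSpace (EuclideanSpace ℝ (Fin d)) X]
  [IsManifold (𝓡 d) ∞ X] [T2Space X] {τ : X → X} {p : X}
  {E : OpenPartialHomeomorph X (EuclideanSpace ℝ (Fin d))}
  {h : EuclideanSpace ℝ (Fin d) → ℝ}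

/-- A smooth function of the coordinates near `p` extends to a smooth function with support in a
given neighbourhood of `p`. -/
lemma exists_contMDiff_eventuallyEq (hE : E ∈ IsManifold.maximalAtlas (𝓡 d) ∞ X)
    (hp : p ∈ E.source) (hh : ContDiff ℝ ∞ h) {W : Set X} (hW : W ∈ 𝓝 p) :
    ∃ B : X → ℝ, ContMDiff (𝓡 d) 𝓘(ℝ, ℝ) ∞ B ∧ B =ᶠ[𝓝 p] h ∘ E ∧ ∀ u ∉ W, B u = 0 := by
  obtain ⟨f, -, hf⟩ := (SmoothBumpFunction.nhds_basis_tsupport (I := 𝓡 d) p).mem_iff.1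
    (Filter.inter_mem hW (E.open_source.mem_nhds hp))
  refine ⟨fun u => f u * h (E u), contMDiff_of_tsupport fun x hx => ?_, ?_, fun u hu => ?_⟩
  · have hx' : x ∈ tsupport f := by
      refine closure_mono (fun z hz => ?_) hx
      exact left_ne_zero_of_mul hz
    exact (f.contMDiff x).mul ((hh.contMDiff.contMDiffAt).comp x
      (contMDiffAt_of_mem_maximalAtlas hE (hf hx').2))
  · filter_upwards [f.eventuallyEq_one] with u hu
    simp [hu]
  · have : f u = 0 := image_eq_zero_of_notMem_tsupport fun hu' => hu (hf hu').1
    simp [this]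

/-- A smooth function of the coordinates near `p` can be symmetrized to an invariant function. -/
lemma exists_invariant_extension (hτ : ContMDiff (𝓡 d) (𝓡 d) ∞ τ) (hττ : Function.Involutive τ)
    (hE : E ∈ IsManifold.maximalAtlas (𝓡 d) ∞ X) (hp : p ∈ E.source) (hh : ContDiff ℝ ∞ h) :
    ∃ G : InvariantCN d τ N, (τ p ≠ p → ∀ᶠ u in 𝓝 p, G.1 u = h (E u)) ∧
      (τ p = p → ∀ᶠ u in 𝓝 p, G.1 u = 2⁻¹ * h (E u) + 2⁻¹ * h (E (τ u))) := by
  -- The weight a is 1/2 at a fixed point, where both terms contribute, and 1 elsewhere, where B ∘ τ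
  -- vanishes near p.
  have sym : ∀ (B : X → ℝ) (a : ℝ), ContMDiff (𝓡 d) 𝓘(ℝ, ℝ) ∞ B →
      ∃ G : InvariantCN d τ N, ∀ u, G.1 u = a * B u + a * B (τ u) := fun B a hB =>
    ⟨⟨⟨fun u => a * B u + a * B (τ u), ((contMDiff_const.mul hB).add
      (contMDiff_const.mul (hB.comp hτ))).of_le (by exact_mod_cast le_top)⟩,
      fun u => by
        change a * B (τ u) + a * B (τ (τ u)) = a * B u + a * B (τ u)
        rw [hττ u, add_comm]⟩, fun u => rfl⟩
  by_cases hfix : τ p = p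
  · obtain ⟨B, hB, hBh, -⟩ := exists_contMDiff_eventuallyEq hE hp hh Filter.univ_mem
    obtain ⟨G, hG⟩ := sym B 2⁻¹ hB
    refine ⟨G, fun h => absurd hfix h, fun _ => ?_⟩
    have : Filter.Tendsto τ (𝓝 p) (𝓝 p) := by
      simpa [hfix] using hτ.continuous.tendsto p
    filter_upwards [hBh, this.eventually hBh] with u h1 h2
    rw [hG, h1, h2]
    rfl
  · obtain ⟨W, W', hW, hW', hpW, hpW', hd⟩ := t2_separation (Ne.symm hfix)
    obtain ⟨B, hB, hBh, hB0⟩ := exists_contMDiff_eventuallyEq hE hp hh (hW.mem_nhds hpW)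
    obtain ⟨G, hG⟩ := sym B 1 hB
    refine ⟨G, fun _ => ?_, fun h => absurd h hfix⟩
    filter_upwards [hBh, hτ.continuous.continuousAt.eventually_mem (hW'.mem_nhds hpW')]
      with u h1 h2
    rw [hG, h1, hB0 _ fun h3 => hd.le_bot ⟨h3, h2⟩]
    simp

variable {m : ℕ} {Y : Type*} [TopologicalSpace Y] [ChartedSpace (EuclideanSpace ℝ (Fin m)) Y]
  {j : Y → X} {y : Y}

/-- There is an invariant function whose restriction to an immersed manifold has a nondegenerate
critical point at a given point. -/
lemma exists_invariant_nondegenerate (hτ : ContMDiff (𝓡 d) (𝓡 d) ∞ τ)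
    (hττ : Function.Involutive τ) (s : SliceAt m d j y) :
    ∃ q : InvariantCN d τ N, fderiv ℝ ((q.1 ∘ j) ∘ s.dom.symm) (s.dom y) = 0 ∧
      (hessMat ((q.1 ∘ j) ∘ s.dom.symm) (s.dom y)).det ≠ 0 := by
  obtain ⟨q, hq1, hq2⟩ := exists_invariant_extension (N := N) hτ hττ s.cod_mem
    (s.mapsTo y s.mem_dom) (contDiff_norm_sub_sq (s.cod (j y)))
  refine ⟨q, ?_⟩
  have hyt : s.dom y ∈ s.dom.target := s.dom.map_source s.mem_dom
  have hsy : s.cod.symm (s.incl (s.dom y)) = j y := by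
    rw [← s.eq_incl y s.mem_dom, s.cod.left_inv (s.mapsTo y s.mem_dom)]
  have htend : Filter.Tendsto (s.cod.symm ∘ s.incl) (𝓝 (s.dom y)) (𝓝 (j y)) := by
    have : ContinuousAt (s.cod.symm ∘ s.incl) (s.dom y) :=
      (s.cod.continuousAt_symm (s.incl_mem hyt)).comp s.incl.continuous.continuousAt
    simpa [ContinuousAt, hsy] using this
  have hmem : ∀ᶠ z in 𝓝 (s.dom y), s.incl z ∈ s.cod.target :=
    s.incl.continuous.continuousAt.eventually_mem (s.cod.open_target.mem_nhds (s.incl_mem hyt))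
  have hrep := s.comp_eventuallyEq (F := q.1) hyt
  have hinj : ∀ v ≠ 0, 0 < ‖s.incl v‖ := fun v hv => by
    rw [norm_pos_iff]
    intro h0
    apply hv
    rw [← s.proj_incl v, h0, map_zero]
  have hincl : ContDiffAt ℝ 2 s.incl (s.dom y) := s.incl.contDiff.contDiffAt
  have hf1 : ContDiffAt ℝ 2 (fun z => ‖s.incl z - s.incl (s.dom y)‖ ^ 2) (s.dom y) :=
    (hincl.sub contDiffAt_const).norm_sq ℝ
  by_cases hfix : τ (j y) = j y
  -- Φ is τ ∘ j in coordinates. The image of j need not be invariant, so q ∘ j is the mean of two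
  -- different squared distances.
  · set Φ : EuclideanSpace ℝ (Fin m) → EuclideanSpace ℝ (Fin d) :=
      (s.cod ∘ τ ∘ s.cod.symm) ∘ s.incl with hΦ
    have hΦy : Φ (s.dom y) = s.incl (s.dom y) := by
      simp only [hΦ, Function.comp_apply, hsy, hfix, s.eq_incl y s.mem_dom]
    have hΦd : ContDiffAt ℝ 2 Φ (s.dom y) := by
      refine ContDiffAt.comp _ ?_ hincl
      refine ContDiffAt.of_le ?_ two_le_infty
      rw [← contMDiffAt_iff_contDiffAt]
      refine ContMDiffAt.comp (I' := 𝓡 d) _ ?_ (ContMDiffAt.comp (I' := 𝓡 d) _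
        (hτ.contMDiffAt) (contMDiffAt_symm_of_mem_maximalAtlas s.cod_mem (s.incl_mem hyt)))
      refine contMDiffAt_of_mem_maximalAtlas s.cod_mem ?_
      rw [Function.comp_apply, hsy, hfix]
      exact s.mapsTo y s.mem_dom
    have hf2 : ContDiffAt ℝ 2 (fun z => ‖Φ z - Φ (s.dom y)‖ ^ 2) (s.dom y) :=
      (hΦd.sub contDiffAt_const).norm_sq ℝ
    -- The shape 0 plus a sum over `Bool` fits `iteratedFDeriv_add_sum`.
    have hq : (q.1 ∘ j) ∘ s.dom.symm =ᶠ[𝓝 (s.dom y)] fun z =>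
        0 + ∑ i : Bool, (fun _ => 2⁻¹) i * (bif i then
          (fun z => ‖s.incl z - s.incl (s.dom y)‖ ^ 2) else
          fun z => ‖Φ z - Φ (s.dom y)‖ ^ 2) z := by
      filter_upwards [hrep, hmem, htend.eventually (hq2 hfix)] with z h1 h2 h3
      rw [h1, Function.comp_apply]
      refine h3.trans ?_
      have h4 : s.cod ((s.cod.symm ∘ s.incl) z) = s.incl z := s.cod.right_inv h2
      rw [h4]
      rw [show s.cod (τ ((s.cod.symm ∘ s.incl) z)) = Φ z from rfl]
      simp [hΦy, s.eq_incl y s.mem_dom]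
    constructor
    · rw [hq.fderiv_eq]
      have e1 := fderiv_norm_sub_sq_comp (hincl.differentiableAt (by simp))
      have e2 := fderiv_norm_sub_sq_comp (hΦd.differentiableAt (by simp))
      have d1 := (hf1.differentiableAt (by simp)).hasFDerivAt
      have d2 := (hf2.differentiableAt (by simp)).hasFDerivAt
      rw [e1] at d1
      rw [e2] at d2
      have := ((d1.const_mul 2⁻¹).add (d2.const_mul 2⁻¹)).fderiv
      simp only [Fintype.sum_bool, cond_true, cond_false, zero_add]
      refine this.trans (by simp)
    · rw [hessMat_congr hq]
      -- The second derivative at (v, v) is ‖incl v‖² + ‖dΦ v‖², and `incl` is injective.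
      apply det_hessMat_ne_zero_of_pos
      intro v hv
      rw [iteratedFDeriv_add_sum (contDiffAt_const) (by
        rintro (_ | _)
        · exact hf2
        · exact hf1)]
      have := hinj v hv
      simp only [Fintype.sum_bool, cond_true, cond_false, add_apply,
        smul_apply, iteratedFDeriv_two_norm_sub_sq_comp hincl,
        iteratedFDeriv_two_norm_sub_sq_comp hΦd, s.incl.fderiv]
      rw [iteratedFDeriv_const_of_ne (by simp)]
      simp only [Pi.zero_apply, zero_apply, smul_eq_mul]
      positivity
  · have hq : (q.1 ∘ j) ∘ s.dom.symm =ᶠ[𝓝 (s.dom y)] fun z =>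
        ‖s.incl z - s.incl (s.dom y)‖ ^ 2 := by
      filter_upwards [hrep, hmem, htend.eventually (hq1 hfix)] with z h1 h2 h3
      rw [h1, Function.comp_apply]
      refine h3.trans ?_
      have h4 : s.cod ((s.cod.symm ∘ s.incl) z) = s.incl z := s.cod.right_inv h2
      rw [h4, s.eq_incl y s.mem_dom]
    constructor
    · rw [hq.fderiv_eq]
      exact fderiv_norm_sub_sq_comp (hincl.differentiableAt (by simp))
    · rw [hessMat_congr hq]
      apply det_hessMat_ne_zero_of_pos
      intro v hv
      rw [iteratedFDeriv_two_norm_sub_sq_comp hincl, s.incl.fderiv]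
      have := hinj v hv
      positivity

end Extension

/-! ### Density along a parametrized submanifold -/

lemma hessMat_add_sum {d : ℕ} {κ : Type*} [Fintype κ] {f : EuclideanSpace ℝ (Fin d) → ℝ}
    {g : κ → EuclideanSpace ℝ (Fin d) → ℝ} {c : κ → ℝ} {y : EuclideanSpace ℝ (Fin d)}
    (hf : ContDiffAt ℝ 2 f y) (hg : ∀ i, ContDiffAt ℝ 2 (g i) y) :
    hessMat (fun z => f z + ∑ i, c i * g i z) y = hessMat f y + ∑ i, c i • hessMat (g i) y := by
  ext a b
  simp [hessMat, iteratedFDeriv_add_sum (j := 2) hf hg, Matrix.sum_apply]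

lemma fderiv_add_sum {E κ : Type*} [NormedAddCommGroup E] [NormedSpace ℝ E] [Fintype κ]
    {f : E → ℝ} {g : κ → E → ℝ} {c : κ → ℝ} {y : E} (hf : DifferentiableAt ℝ f y)
    (hg : ∀ i, DifferentiableAt ℝ (g i) y) :
    fderiv ℝ (fun z => f z + ∑ i, c i * g i z) y = fderiv ℝ f y + ∑ i, c i • fderiv ℝ (g i) y :=
  (hf.hasFDerivAt.add (HasFDerivAt.fun_sum fun i _ => (hg i).hasFDerivAt.const_mul (c i))).fderiv

/-- The gradient of a function on a Euclidean space. -/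
noncomputable def grad {r : ℕ} (h : EuclideanSpace ℝ (Fin r) → ℝ)
    (y : EuclideanSpace ℝ (Fin r)) : EuclideanSpace ℝ (Fin r) :=
  WithLp.toLp 2 fun i => fderiv ℝ h y (EuclideanSpace.single i 1)

lemma differentiableOn_grad {r : ℕ} {h : EuclideanSpace ℝ (Fin r) → ℝ}
    {U : Set (EuclideanSpace ℝ (Fin r))} (hU : IsOpen U) (hh : ContDiffOn ℝ 2 h U) :
    DifferentiableOn ℝ (grad h) U := by
  rw [differentiableOn_euclidean]
  intro i
  have : DifferentiableOn ℝ (fderiv ℝ h) U :=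
    (hh.fderiv_of_isOpen hU (m := 1) (by norm_num)).differentiableOn (by simp)
  exact this.clm_apply (differentiableOn_const _)

lemma continuousOn_hessMat {d : ℕ} {h : EuclideanSpace ℝ (Fin d) → ℝ}
    {U : Set (EuclideanSpace ℝ (Fin d))} (hU : IsOpen U) (hh : ContDiffOn ℝ 2 h U) :
    ContinuousOn (hessMat h) U := by
  refine continuousOn_pi.2 fun i => continuousOn_pi.2 fun k => ?_
  intro y hy
  exact ((continuous_eval_const _).continuousAt.comp ((hh.contDiffAt
    (hU.mem_nhds hy)).continuousAt_iteratedFDeriv (k := 2) le_rfl)).continuousWithinAt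

section

variable {m d r N : ℕ} (hN : 2 ≤ N) {Y : Type*} [TopologicalSpace Y]
  [ChartedSpace (EuclideanSpace ℝ (Fin m)) Y] [IsManifold (𝓡 m) ∞ Y]
  {X : Type*} [TopologicalSpace X] [ChartedSpace (EuclideanSpace ℝ (Fin d)) X]
  [IsManifold (𝓡 d) ∞ X] {τ : X → X} {j : Y → X} (hj : ContMDiff (𝓡 m) (𝓡 d) ∞ j)

include hN hj in
/-- If some invariant functions restrict to coordinates on a parametrized submanifold, then for a
generic invariant function the critical points of its restriction which lie on that submanifold
are nondegenerate. -/
lemma dense_morse_along {e : OpenPartialHomeomorph Y (EuclideanSpace ℝ (Fin m))}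
    (he : e ∈ IsManifold.maximalAtlas (𝓡 m) ∞ Y) {U : Set (EuclideanSpace ℝ (Fin r))}
    (hU : IsOpen U) {y₀ : EuclideanSpace ℝ (Fin r)} (hy₀ : y₀ ∈ U)
    {ψ : EuclideanSpace ℝ (Fin r) → EuclideanSpace ℝ (Fin m)} (hψ : ContDiffOn ℝ ∞ ψ U)
    (hψU : Set.MapsTo ψ U e.target) (g : Fin r → InvariantCN d τ N)
    (hg : ∀ i, ∀ y ∈ U, (g i).1 (j (e.symm (ψ y))) = y i) (q : InvariantCN d τ N)
    (hq0 : fderiv ℝ ((q.1 ∘ j) ∘ e.symm) (ψ y₀) = 0)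
    (hq : (hessMat ((q.1 ∘ j) ∘ e.symm) (ψ y₀)).det ≠ 0) :
    ∃ V ∈ 𝓝 y₀, V ⊆ U ∧ Dense {F : InvariantCN d τ N | ∀ y ∈ V,
      IsCriticalPoint m (F.1 ∘ j) (e.symm (ψ y)) →
        (hessianMatrix m (F.1 ∘ j) (e.symm (ψ y))).det ≠ 0} := by
  set rep : InvariantCN d τ N → EuclideanSpace ℝ (Fin m) → ℝ :=
    fun F => (F.1 ∘ j) ∘ e.symm with hrep
  have hC : ∀ F : InvariantCN d τ N, ContMDiff (𝓡 m) 𝓘(ℝ, ℝ) 2 (F.1 ∘ j) := fun F =>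
    (F.1.contMDiff.of_le (by exact_mod_cast hN)).comp (hj.of_le two_le_infty)
  have hrepC : ∀ F, ContDiffOn ℝ 2 (rep F) e.target := fun F =>
    contDiffOn_comp_symm (n := 2) (hC F) he
  have hrepA : ∀ F, ∀ z ∈ e.target, ContDiffAt ℝ 2 (rep F) z := fun F z hz =>
    (hrepC F).contDiffAt (e.open_target.mem_nhds hz)
  have hψ2 : ContDiffOn ℝ 2 ψ U := hψ.of_le two_le_infty
  have hψA : ∀ y ∈ U, ContDiffAt ℝ 2 ψ y := fun y hy => hψ2.contDiffAt (hU.mem_nhds hy)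
  have hcomp : ∀ F, ContDiffOn ℝ 2 (rep F ∘ ψ) U := fun F => (hrepC F).comp hψ2 hψU
  have hcompA : ∀ F, ∀ y ∈ U, DifferentiableAt ℝ (rep F ∘ ψ) y := fun F y hy =>
    ((hcomp F).contDiffAt (hU.mem_nhds hy)).differentiableAt (by simp)
  have hhess : ∀ F, ContinuousOn (fun y => hessMat (rep F) (ψ y)) U := fun F =>
    (continuousOn_hessMat e.open_target (hrepC F)).comp hψ2.continuousOn hψU
  have hgrad : ∀ F, DifferentiableOn ℝ (grad (rep F ∘ ψ)) U := fun F =>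
    differentiableOn_grad hU (hcomp F)
  -- The Hessian of H, corrected by the combination of the g i that cancels the differential of H
  -- along ψ. Additivity in H will produce the pencil `A F y + s • A q y`.
  set A : InvariantCN d τ N → EuclideanSpace ℝ (Fin r) → Matrix (Fin m) (Fin m) ℝ := fun F y =>
    hessMat (rep F) (ψ y) - ∑ i, grad (rep F ∘ ψ) y i • hessMat (rep (g i)) (ψ y) with hA
  have hAc : ∀ F, ContinuousOn (A F) U := fun F => by
    refine (hhess F).sub (continuousOn_finsetSum _ fun i _ => ?_)
    refine ContinuousOn.fun_smul ?_ (hhess (g i))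
    exact (differentiableOn_euclidean.1 (hgrad F) i).continuousOn
  -- At y₀ the correction vanishes because q is critical there, so `A q y₀` is the invertible
  -- Hessian of q.
  set V := U ∩ {y | (A q y).det ≠ 0} with hV
  have hVo : IsOpen V :=
    ((continuous_id.matrix_det).comp_continuousOn (hAc q)).isOpen_inter_preimage hU
      (isOpen_compl_singleton (x := (0 : ℝ)))
  have hVU : V ⊆ U := Set.inter_subset_left
  have hyV : y₀ ∈ V := by
    refine ⟨hy₀, ?_⟩
    have h0 : grad (rep q ∘ ψ) y₀ = 0 := by
      ext i
      have : fderiv ℝ (rep q ∘ ψ) y₀ = 0 := by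
        rw [fderiv_comp _ ((hrepA q _ (hψU hy₀)).differentiableAt (by simp))
          ((hψA _ hy₀).differentiableAt (by simp)), hq0, ContinuousLinearMap.zero_comp]
      simp [grad, this]
    simpa [hA, h0] using hq
  refine ⟨V, hVo.mem_nhds hyV, hVU, ?_⟩
  rw [dense_iff_inter_open]
  rintro O hO ⟨F, hF⟩
  set G : Fin r ⊕ Unit → InvariantCN d τ N := Sum.elim g fun _ => q with hG
  set Φ : EuclideanSpace ℝ (Fin r) × ℝ → InvariantCN d τ N :=
    fun p => perturb F G (Sum.elim (WithLp.ofLp p.1) fun _ => p.2) with hΦ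
  have hΦc : Continuous Φ := by
    refine (continuous_perturb F G).comp (continuous_pi ?_)
    rintro (i | i)
    · exact (EuclideanSpace.proj (𝕜 := ℝ) i).continuous.comp continuous_fst
    · exact continuous_snd
  have hΦ0 : Φ 0 = F := by
    rw [hΦ]
    convert perturb_zero F G using 2
    ext (i | i) <;> simp
  have hae := ae_forall_eq_det_ne_zero (a := fun y => -grad (rep F ∘ ψ) y)
    (b := fun y => -grad (rep q ∘ ψ) y) hVo ((hgrad F).mono hVU).neg ((hgrad q).mono hVU).neg
    ((hAc F).mono hVU) ((hAc q).mono hVU) fun y hy => hy.2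
  have : (MeasureTheory.volume :
      MeasureTheory.Measure (EuclideanSpace ℝ (Fin r) × ℝ)).IsAddHaarMeasure := by
    rw [MeasureTheory.Measure.volume_eq_prod]; infer_instance
  obtain ⟨⟨t, s⟩, hts, hgood⟩ := (MeasureTheory.Measure.dense_of_ae hae).inter_open_nonempty
    (Φ ⁻¹' O) (hO.preimage hΦc) ⟨0, by rw [Set.mem_preimage, hΦ0]; exact hF⟩
  refine ⟨Φ (t, s), hts, fun y hy => ?_⟩
  have hyU := hVU hy
  have hyt := hψU hyU
  rw [morse_condition_iff (hC _) he (e.map_target hyt), e.right_inv hyt]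
  intro hcrit
  have e1 : rep (Φ (t, s)) = fun z => rep F z + ∑ i, (Sum.elim (WithLp.ofLp t) fun _ => s) i *
      rep (G i) z := rfl
  have e2 : rep (Φ (t, s)) ∘ ψ = fun z => (rep F ∘ ψ) z +
      ∑ i, (Sum.elim (WithLp.ofLp t) fun _ => s) i * (rep (G i) ∘ ψ) z := rfl
  have hc0 : fderiv ℝ (rep (Φ (t, s)) ∘ ψ) y = 0 := by
    rw [fderiv_comp _ ((hrepA _ _ hyt).differentiableAt (by simp))
      ((hψA _ hyU).differentiableAt (by simp))]
    refine (congrArg (fun T => ContinuousLinearMap.comp T _) hcrit).trans ?_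
    exact ContinuousLinearMap.zero_comp _
  have hcoord : ∀ i, fderiv ℝ (rep (g i) ∘ ψ) y = EuclideanSpace.proj i := by
    intro i
    have : rep (g i) ∘ ψ =ᶠ[𝓝 y] EuclideanSpace.proj (𝕜 := ℝ) i := by
      filter_upwards [hU.mem_nhds hyU] with z hz
      exact hg i z hz
    rw [this.fderiv_eq]
    exact (EuclideanSpace.proj (𝕜 := ℝ) i).fderiv
  rw [e2, fderiv_add_sum (hcompA F y hyU) fun i => hcompA (G i) y hyU] at hc0
  -- Since the g i restrict to coordinates, criticality along ψ can be solved for t.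
  have ht : t = -grad (rep F ∘ ψ) y + s • -grad (rep q ∘ ψ) y := by
    ext k
    have := congrArg (fun T => T (EuclideanSpace.single k 1)) hc0
    simp [Fintype.sum_sum_type, hG, hcoord] at this
    simp [grad]
    linarith
  have hdet := hgood y hy ht
  rw [show ((Φ (t, s)).1 ∘ j) ∘ e.symm = rep (Φ (t, s)) from rfl, e1,
    hessMat_add_sum (hrepA F _ hyt) fun i => hrepA (G i) _ hyt]
  -- Inserting the value of t turns the perturbed Hessian into the pencil.
  convert hdet using 2
  simp only [Fintype.sum_sum_type, hG, hA, Sum.elim_inl, Sum.elim_inr, Finset.univ_unique,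
    Finset.sum_singleton]
  rw [smul_sub, Finset.smul_sum]
  have ht' : ∀ k, t k = -grad (rep F ∘ ψ) y k + s * -grad (rep q ∘ ψ) y k := fun k => by
    rw [ht]; simp
  simp only [ht', add_smul, Finset.sum_add_distrib, neg_smul, Finset.sum_neg_distrib, mul_neg,
    mul_smul]
  abel

end

section

variable {d r n N : ℕ} {X : Type*} [TopologicalSpace X]
  [ChartedSpace (EuclideanSpace ℝ (Fin d)) X] [IsManifold (𝓡 d) ∞ X] {τ : X → X}

/-- If some invariant functions have independent differentials along a parametrized submanifold
of smaller dimension, then a generic invariant function has no critical points there. -/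
lemma dense_not_critical_along (hN : 2 ≤ N) (hrn : r < n)
    {e : OpenPartialHomeomorph X (EuclideanSpace ℝ (Fin d))}
    (he : e ∈ IsManifold.maximalAtlas (𝓡 d) ∞ X) {U : Set (EuclideanSpace ℝ (Fin r))}
    (hUc : Convex ℝ U)
    {ψ : EuclideanSpace ℝ (Fin r) → EuclideanSpace ℝ (Fin d)} (hψ : ContDiffOn ℝ ∞ ψ U)
    (hψU : Set.MapsTo ψ U e.target) (g : Fin n → InvariantCN d τ N)
    (v : Fin n → EuclideanSpace ℝ (Fin d))
    (hg : ∀ i k, ∀ y ∈ U, fderiv ℝ ((g i).1 ∘ e.symm) (ψ y) (v k) = if i = k then 1 else 0) :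
    Dense {F : InvariantCN d τ N | ∀ y ∈ U, ¬ IsCriticalPoint d F.1 (e.symm (ψ y))} := by
  rw [dense_iff_inter_open]
  rintro O hO ⟨F, hF⟩
  have hC : ∀ F : InvariantCN d τ N, ContMDiff (𝓡 d) 𝓘(ℝ, ℝ) 2 F.1 := fun F =>
    F.1.contMDiff.of_le (by exact_mod_cast hN)
  have hrepC : ∀ F : InvariantCN d τ N, ContDiffOn ℝ 2 (F.1 ∘ e.symm) e.target := fun F =>
    contDiffOn_comp_symm (n := 2) (hC F) he
  have hrepA : ∀ F : InvariantCN d τ N, ∀ z ∈ e.target, DifferentiableAt ℝ (F.1 ∘ e.symm) z :=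
    fun F z hz => ((hrepC F).contDiffAt (e.open_target.mem_nhds hz)).differentiableAt (by simp)
  -- If the perturbation by t is critical at ψ y, pairing its differential with each v k gives t = γ
  -- y.
  set γ : EuclideanSpace ℝ (Fin r) → EuclideanSpace ℝ (Fin n) := fun y =>
    WithLp.toLp 2 fun k => -fderiv ℝ (F.1 ∘ e.symm) (ψ y) (v k) with hγ
  have hγC : ContDiffOn ℝ 1 γ U := by
    rw [contDiffOn_euclidean]
    intro k
    refine ContDiffOn.neg (ContDiffOn.clm_apply ?_ contDiffOn_const)
    exact ((hrepC F).fderiv_of_isOpen e.open_target (m := 1) (by norm_num)).comp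
      (hψ.of_le (by exact_mod_cast le_top)) hψU
  -- A C¹ image of an r-dimensional set has Hausdorff dimension at most r < n.
  have hdense : Dense (γ '' U)ᶜ := by
    refine hγC.dense_compl_image_of_dimH_lt_finrank hUc le_rfl ?_
    refine (dimH_mono (Set.subset_univ U)).trans_lt ?_
    rw [Real.dimH_univ_eq_finrank]
    simpa using hrn
  set Φ : EuclideanSpace ℝ (Fin n) → InvariantCN d τ N := fun t => perturb F g (WithLp.ofLp t)
  have hΦc : Continuous Φ := (continuous_perturb F g).comp
    (continuous_pi fun i => (EuclideanSpace.proj (𝕜 := ℝ) i).continuous)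
  have hΦ0 : Φ 0 = F := perturb_zero F g
  obtain ⟨t, ht, hgood⟩ := hdense.inter_open_nonempty (Φ ⁻¹' O) (hO.preimage hΦc)
    ⟨0, by rw [Set.mem_preimage, hΦ0]; exact hF⟩
  refine ⟨Φ t, ht, fun y hy hcrit => hgood ⟨y, hy, ?_⟩⟩
  have hyt := hψU hy
  rw [isCriticalPoint_iff ((hC _).of_le (by norm_num)) he (e.map_target hyt),
    e.right_inv hyt] at hcrit
  have e1 : (Φ t).1 ∘ e.symm = fun z => (F.1 ∘ e.symm) z + ∑ i, t i * ((g i).1 ∘ e.symm) z := rfl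
  rw [e1, fderiv_add_sum (hrepA F _ hyt) fun i => hrepA (g i) _ hyt] at hcrit
  ext k
  have := congrArg (fun T => T (v k)) hcrit
  simp [hg _ _ y hy] at this
  simp only [hγ]
  linarith

end

/-! ### Invariant coordinates near a point -/

section

variable {d N : ℕ} {X : Type*} [TopologicalSpace X] [ChartedSpace (EuclideanSpace ℝ (Fin d)) X]

/-- Linear coordinates near a point extend to invariant functions; at a fixed point the extension
agrees with the coordinates on the fixed points. -/
lemma exists_invariant_coordinates [IsManifold (𝓡 d) ∞ X] [T2Space X] {τ : X → X}
    (hτ : ContMDiff (𝓡 d) (𝓡 d) ∞ τ) (hττ : Function.Involutive τ)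
    {E : OpenPartialHomeomorph X (EuclideanSpace ℝ (Fin d))}
    (hE : E ∈ IsManifold.maximalAtlas (𝓡 d) ∞ X) {p : X} (hp : p ∈ E.source) {n : ℕ}
    (L : EuclideanSpace ℝ (Fin d) →L[ℝ] EuclideanSpace ℝ (Fin n)) :
    ∃ (G : Fin n → InvariantCN d τ N) (O : Set X), IsOpen O ∧ p ∈ O ∧
      ∀ u ∈ O, τ p ≠ p ∨ τ u = u → ∀ i, (G i).1 u = L (E u) i := by
  choose G hG1 hG2 using fun i : Fin n => exists_invariant_extension (N := N) hτ hττ hE hp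
    (h := fun y => L y i) ((EuclideanSpace.proj (𝕜 := ℝ) i).contDiff.comp L.contDiff)
  have key : ∀ᶠ u in 𝓝 p, τ p ≠ p ∨ τ u = u → ∀ i, (G i).1 u = L (E u) i := by
    by_cases hfix : τ p = p
    · filter_upwards [Filter.eventually_all.2 fun i => hG2 i hfix] with u hu h i
      rw [hu i, h.resolve_left (not_not.2 hfix)]
      ring
    · filter_upwards [Filter.eventually_all.2 fun i => hG1 i hfix] with u hu _ i
      exact hu i
  obtain ⟨O, hO, hOo, hpO⟩ := mem_nhds_iff.1 key
  exact ⟨G, O, hOo, hpO, hO⟩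

/-- The subspace topology lets a chart neighbourhood in S be cut out by an ambient open set, which
can then be pulled back along j. -/
lemma SliceAt.exists_isOpen {r : ℕ} {S : Set X} [ChartedSpace (EuclideanSpace ℝ (Fin r)) S]
    {p : S} (s : SliceAt r d (Subtype.val : S → X) p) {V : Set (EuclideanSpace ℝ (Fin r))}
    (hV : V ∈ 𝓝 (s.dom p)) :
    ∃ O : Set X, IsOpen O ∧ p.1 ∈ O ∧ ∀ w : S, w.1 ∈ O → w ∈ s.dom.source ∧ s.dom w ∈ V := by
  have h : {w | w ∈ s.dom.source ∧ s.dom w ∈ V} ∈ 𝓝 p :=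
    Filter.inter_mem (s.dom.open_source.mem_nhds s.mem_dom) (s.dom.continuousAt s.mem_dom hV)
  obtain ⟨T, hT, hTp⟩ := mem_nhds_induced _ _ _ |>.1 h
  obtain ⟨O, hO, hOo, hpO⟩ := mem_nhds_iff.1 hT
  exact ⟨O, hOo, hpO, fun w hw => hTp (hO hw)⟩

end

/-! ### The genericity theorems -/

section

variable {m d r N : ℕ} {Y : Type*} [TopologicalSpace Y]
  [ChartedSpace (EuclideanSpace ℝ (Fin m)) Y] [IsManifold (𝓡 m) ∞ Y] [T2Space Y] [CompactSpace Y]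
  {X : Type*} [TopologicalSpace X] [T2Space X] [ChartedSpace (EuclideanSpace ℝ (Fin d)) X]
  [IsManifold (𝓡 d) ∞ X] {τ : X → X} {j : Y → X}

/-- Invariant functions with a Morse restriction to an embedded closed manifold are generic. -/
theorem isOpen_and_dense_morse (hN : 2 ≤ N) (hτ : ContMDiff (𝓡 d) (𝓡 d) ∞ τ)
    (hττ : Function.Involutive τ) (hj : Manifold.IsSmoothEmbedding (𝓡 m) (𝓡 d) ∞ j)
    (hS : IsSubmanifold (d := d) r (Set.range j ∩ Function.fixedPoints τ)) :
    IsOpen {F : InvariantCN d τ N | IsMorse m (F.1 ∘ j)} ∧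
      Dense {F : InvariantCN d τ N | IsMorse m (F.1 ∘ j)} := by
  have hjc : Continuous j := hj.contMDiff.continuous
  refine isOpen_and_dense_setOf_forall_mem (isOpen_setOf_morse_condition hN hj.isImmersion)
    (Z := {u | τ (j u) = j u}) (isClosed_eq (hτ.continuous.comp hjc) hjc) ?_ ?_
  · rintro z₀ (hz₀ : j z₀ ∈ Function.fixedPoints τ)
    obtain ⟨_, _, hval⟩ := hS
    obtain ⟨s⟩ := nonempty_sliceAt (hj.isImmersion.isImmersionAt z₀)
    set p : ↥(Set.range j ∩ Function.fixedPoints τ) := ⟨j z₀, ⟨z₀, rfl⟩, hz₀⟩ with hp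
    obtain ⟨sZ⟩ := nonempty_sliceAt (hval.isImmersion.isImmersionAt p)
    obtain ⟨g, O, hO, hpO, hg⟩ := exists_invariant_coordinates (N := N) hτ hττ sZ.cod_mem
      (sZ.mapsTo p sZ.mem_dom) sZ.proj
    -- As j is an embedding, the chart domain in Y is the preimage of an open O' ⊆ X.
    obtain ⟨O', hO', hO's⟩ := hj.isEmbedding.isInducing.isOpen_iff.1 s.dom.open_source
    have hmemO' : ∀ x, j x ∈ O' ↔ x ∈ s.dom.source := fun x => by rw [← hO's]; rfl
    obtain ⟨q, hq0, hq⟩ := exists_invariant_nondegenerate (N := N) hτ hττ s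
    set U : Set (EuclideanSpace ℝ (Fin r)) :=
      sZ.dom.target ∩ sZ.dom.symm ⁻¹' (Subtype.val ⁻¹' (O ∩ O')) with hU
    have hUo : IsOpen U := sZ.dom.symm.isOpen_inter_preimage
      ((hO.inter hO').preimage continuous_subtype_val)
    have hyU : sZ.dom p ∈ U := by
      refine ⟨sZ.dom.map_source sZ.mem_dom, ?_⟩
      rw [Set.mem_preimage, sZ.dom.left_inv sZ.mem_dom]
      exact ⟨hpO, (hmemO' z₀).2 s.mem_dom⟩
    -- The inclusion of Z into Y in coordinates, obtained by passing through X; `proj` undoes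
    -- `incl`. No submanifold structure of Z inside Y is needed.
    set ψ : EuclideanSpace ℝ (Fin r) → EuclideanSpace ℝ (Fin m) := fun y =>
      s.proj (s.cod (sZ.dom.symm y).1) with hψ
    have hψpt : ∀ y ∈ U, ∀ x, j x = (sZ.dom.symm y).1 → x ∈ s.dom.source ∧ ψ y = s.dom x := by
      intro y hy x hx
      have hxs : x ∈ s.dom.source := by
        rw [← hmemO', hx]; exact hy.2.2
      refine ⟨hxs, ?_⟩
      rw [hψ]
      simp only
      rw [← hx, s.eq_incl x hxs, s.proj_incl]
    have hψC : ContDiffOn ℝ ∞ ψ U := by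
      refine s.proj.contDiff.comp_contDiffOn ?_
      rw [← contMDiffOn_iff_contDiffOn]
      refine (contMDiffOn_of_mem_maximalAtlas s.cod_mem).comp
        (hval.contMDiff.comp_contMDiffOn
          ((contMDiffOn_symm_of_mem_maximalAtlas sZ.dom_mem).mono fun y hy => hy.1)) ?_
      intro y hy
      obtain ⟨x, hx⟩ := (sZ.dom.symm y).2.1
      rw [Set.mem_preimage, ← hx]
      exact s.mapsTo x (hψpt y hy x hx).1
    have hψU : Set.MapsTo ψ U s.dom.target := by
      intro y hy
      obtain ⟨x, hx⟩ := (sZ.dom.symm y).2.1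
      rw [(hψpt y hy x hx).2]
      exact s.dom.map_source (hψpt y hy x hx).1
    have hψsymm : ∀ y ∈ U, j (s.dom.symm (ψ y)) = (sZ.dom.symm y).1 := by
      intro y hy
      obtain ⟨x, hx⟩ := (sZ.dom.symm y).2.1
      rw [(hψpt y hy x hx).2, s.dom.left_inv (hψpt y hy x hx).1, hx]
    have hψ0 : ψ (sZ.dom p) = s.dom z₀ := by
      refine (hψpt _ hyU z₀ ?_).2
      rw [sZ.dom.left_inv sZ.mem_dom]
    have hgψ : ∀ i, ∀ y ∈ U, (g i).1 (j (s.dom.symm (ψ y))) = y i := fun i y hy => by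
      rw [hψsymm y hy, hg _ hy.2.1 (Or.inr (sZ.dom.symm y).2.2), sZ.eq_incl_symm hy.1,
        sZ.proj_incl]
    obtain ⟨V, hV, hVU, hd⟩ := dense_morse_along hN hj.contMDiff s.dom_mem hUo hyU hψC hψU g hgψ q
      (by rw [hψ0]; exact hq0) (by rw [hψ0]; exact hq)
    obtain ⟨T, hT, hpT, hTV⟩ := sZ.exists_isOpen hV
    refine ⟨j ⁻¹' T, (hT.preimage hjc).mem_nhds hpT, hd.mono ?_⟩
    rintro F hF u ⟨huT, huZ⟩
    obtain ⟨h1, h2⟩ := hTV ⟨j u, ⟨u, rfl⟩, huZ⟩ huT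
    have h3 := hF _ h2
    have h4 : s.dom.symm (ψ (sZ.dom ⟨j u, ⟨u, rfl⟩, huZ⟩)) = u := by
      apply hj.isEmbedding.injective
      rw [hψsymm _ (hVU h2), sZ.dom.left_inv h1]
    rw [h4] at h3
    exact h3
  · intro x hx
    obtain ⟨s⟩ := nonempty_sliceAt (hj.isImmersion.isImmersionAt x)
    -- Off the fixed points all m coordinates of Y extend to invariant functions, so the
    -- parametrization is the identity.
    obtain ⟨g, O, hO, hpO, hg⟩ := exists_invariant_coordinates (N := N) hτ hττ s.cod_mem
      (s.mapsTo x s.mem_dom) s.proj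
    obtain ⟨q, hq0, hq⟩ := exists_invariant_nondegenerate (N := N) hτ hττ s
    have hUo : IsOpen (s.dom.target ∩ s.dom.symm ⁻¹' (j ⁻¹' O)) :=
      s.dom.symm.isOpen_inter_preimage (hO.preimage hjc)
    obtain ⟨V, hV, hVU, hd⟩ := dense_morse_along hN hj.contMDiff s.dom_mem hUo (ψ := id)
      ⟨s.dom.map_source s.mem_dom, by
        rw [Set.mem_preimage, s.dom.left_inv s.mem_dom]; exact hpO⟩ contDiffOn_id
      (fun y hy => hy.1) g (fun i y hy => by
        rw [id, hg _ hy.2 (Or.inl hx), s.eq_incl_symm hy.1, s.proj_incl]) q hq0 hq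
    refine ⟨s.dom.source ∩ s.dom ⁻¹' V, Filter.inter_mem (s.dom.open_source.mem_nhds s.mem_dom)
      (s.dom.continuousAt s.mem_dom hV), hd.mono ?_⟩
    rintro F hF u ⟨hu, huV⟩
    have h3 := hF _ huV
    rw [id, s.dom.left_inv hu] at h3
    exact h3

omit [IsManifold (𝓡 m) ∞ Y] in
/-- Invariant functions without critical points on an embedded closed manifold of positive
codimension are generic. -/
theorem isOpen_and_dense_not_critical {n : ℕ} (hN : 2 ≤ N) (hτ : ContMDiff (𝓡 d) (𝓡 d) ∞ τ)
    (hττ : Function.Involutive τ) (hmd : m < d)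
    (hj : Manifold.IsSmoothEmbedding (𝓡 m) (𝓡 d) ∞ j)
    (hfix : IsSubmanifold (d := d) n (Function.fixedPoints τ))
    (hS : IsSubmanifold (d := d) r (Set.range j ∩ Function.fixedPoints τ))
    (hrn : (Set.range j ∩ Function.fixedPoints τ).Nonempty → r < n) :
    IsOpen {F : InvariantCN d τ N | ∀ u, ¬ IsCriticalPoint d F.1 (j u)} ∧
      Dense {F : InvariantCN d τ N | ∀ u, ¬ IsCriticalPoint d F.1 (j u)} := by
  have hjc : Continuous j := hj.contMDiff.continuous
  have hcd : ∀ (F : InvariantCN d τ N) {e : OpenPartialHomeomorph X (EuclideanSpace ℝ (Fin d))},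
      e ∈ IsManifold.maximalAtlas (𝓡 d) ∞ X → ∀ z ∈ e.target,
      DifferentiableAt ℝ (F.1 ∘ e.symm) z := fun F e he z hz =>
    (contDiffAt_comp_symm F.1.contMDiff he hz).differentiableAt
      (by exact_mod_cast (by omega : N ≠ 0))
  refine isOpen_and_dense_setOf_forall_mem (isOpen_setOf_not_isCriticalPoint (by omega) hjc)
    (Z := {u | τ (j u) = j u}) (isClosed_eq (hτ.continuous.comp hjc) hjc) ?_ ?_
  · rintro z₀ (hz₀ : j z₀ ∈ Function.fixedPoints τ)
    have hrn := hrn ⟨j z₀, ⟨z₀, rfl⟩, hz₀⟩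
    obtain ⟨_, _, hvalF⟩ := hfix
    obtain ⟨_, _, hval⟩ := hS
    set p : ↥(Set.range j ∩ Function.fixedPoints τ) := ⟨j z₀, ⟨z₀, rfl⟩, hz₀⟩ with hp
    obtain ⟨sZ⟩ := nonempty_sliceAt (hval.isImmersion.isImmersionAt p)
    obtain ⟨s⟩ := nonempty_sliceAt
      (hvalF.isImmersion.isImmersionAt (⟨j z₀, hz₀⟩ : Function.fixedPoints τ))
    obtain ⟨g, O, hO, hpO, hg⟩ := exists_invariant_coordinates (N := N) hτ hττ s.cod_mem
      (s.mapsTo _ s.mem_dom) s.proj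
    obtain ⟨T, hT, hpT, hTs⟩ := s.exists_isOpen Filter.univ_mem
    have hnhds : sZ.dom.target ∩ sZ.dom.symm ⁻¹' (Subtype.val ⁻¹' (O ∩ T)) ∈ 𝓝 (sZ.dom p) := by
      refine (sZ.dom.symm.isOpen_inter_preimage
        ((hO.inter hT).preimage continuous_subtype_val)).mem_nhds
          ⟨sZ.dom.map_source sZ.mem_dom, ?_⟩
      rw [Set.mem_preimage, sZ.dom.left_inv sZ.mem_dom]
      exact ⟨hpO, hpT⟩
    -- A ball, because `dense_not_critical_along` asks for a convex domain.
    obtain ⟨ε, hε, hball⟩ := Metric.mem_nhds_iff.1 hnhds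
    have hpt : ∀ y ∈ Metric.ball (sZ.dom p) ε, ∃ w : Function.fixedPoints τ,
        w.1 = (sZ.dom.symm y).1 ∧ w ∈ s.dom.source ∧ w.1 ∈ O := fun y hy =>
      ⟨⟨(sZ.dom.symm y).1, (sZ.dom.symm y).2.2⟩, rfl, (hTs _ (hball hy).2.2).1, (hball hy).2.1⟩
    have hψC : ContDiffOn ℝ ∞ (fun y => s.cod (sZ.dom.symm y).1) (Metric.ball (sZ.dom p) ε) := by
      rw [← contMDiffOn_iff_contDiffOn]
      refine (contMDiffOn_of_mem_maximalAtlas s.cod_mem).comp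
        (hval.contMDiff.comp_contMDiffOn ((contMDiffOn_symm_of_mem_maximalAtlas
          sZ.dom_mem).mono fun y hy => (hball hy).1)) ?_
      intro y hy
      obtain ⟨w, hw, hws, -⟩ := hpt y hy
      rw [Set.mem_preimage, ← hw]
      exact s.mapsTo w hws
    -- The test vectors are tangent to the fixed set: the g i are known to be coordinates only
    -- there.
    have hd := dense_not_critical_along (ψ := fun y => s.cod (sZ.dom.symm y).1) hN hrn s.cod_mem
      (convex_ball (sZ.dom p) ε) hψC (fun y hy => ?_) g
      (fun k => s.incl (EuclideanSpace.single k 1)) fun i k y hy => ?_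
    · obtain ⟨T', hT', hpT', hTV⟩ := sZ.exists_isOpen (Metric.ball_mem_nhds (sZ.dom p) hε)
      refine ⟨j ⁻¹' T', (hT'.preimage hjc).mem_nhds hpT', hd.mono ?_⟩
      rintro F hF u ⟨huT, huZ⟩
      obtain ⟨h1, h2⟩ := hTV ⟨j u, ⟨u, rfl⟩, huZ⟩ huT
      have h3 := hF _ h2
      obtain ⟨w, hw, hws, -⟩ := hpt _ h2
      simp only [← hw, s.cod.left_inv (s.mapsTo w hws)] at h3
      rw [hw, sZ.dom.left_inv h1] at h3
      exact h3
    · obtain ⟨w, hw, hws, -⟩ := hpt y hy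
      simp only [← hw]
      exact s.cod.map_source (s.mapsTo w hws)
    · obtain ⟨w, hw, hws, hwO⟩ := hpt y hy
      have hwt := s.dom.map_source hws
      simp only [← hw, s.eq_incl w hws]
      have hev : ((g i).1 ∘ s.cod.symm) ∘ s.incl =ᶠ[𝓝 (s.dom w)]
          EuclideanSpace.proj (𝕜 := ℝ) i := by
        have h1 : ∀ᶠ z in 𝓝 (s.dom w), (s.dom.symm z).1 ∈ O := by
          refine (continuous_subtype_val.continuousAt.comp
            (s.dom.continuousAt_symm hwt)).eventually_mem (hO.mem_nhds ?_)
          rw [Function.comp_apply, s.dom.left_inv hws]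
          exact hwO
        filter_upwards [h1, s.dom.open_target.mem_nhds hwt] with z hz1 hz2
        refine (s.comp_eq (F := (g i).1) hz2).symm.trans ?_
        rw [hg _ hz1 (Or.inr (s.dom.symm z).2), s.eq_incl_symm hz2, s.proj_incl]
        rfl
      have h2 := hev.fderiv_eq (𝕜 := ℝ)
      rw [fderiv_comp _ (hcd (g i) s.cod_mem _ (s.incl_mem hwt)) s.incl.differentiableAt,
        ContinuousLinearMap.fderiv, ContinuousLinearMap.fderiv] at h2
      have h3 := DFunLike.congr_fun h2 (EuclideanSpace.single k 1)
      simpa [Pi.single_apply] using h3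
  · intro x hx
    obtain ⟨s⟩ := nonempty_sliceAt (hj.isImmersion.isImmersionAt x)
    -- With the identity as L there are d invariant coordinates, against dimension m < d of Y.
    obtain ⟨g, O, hO, hpO, hg⟩ := exists_invariant_coordinates (N := N) hτ hττ s.cod_mem
      (s.mapsTo x s.mem_dom) (ContinuousLinearMap.id ℝ _)
    have hnhds : s.dom.target ∩ s.dom.symm ⁻¹' (j ⁻¹' O) ∈ 𝓝 (s.dom x) := by
      refine (s.dom.symm.isOpen_inter_preimage (hO.preimage hjc)).mem_nhds
        ⟨s.dom.map_source s.mem_dom, ?_⟩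
      rw [Set.mem_preimage, s.dom.left_inv s.mem_dom]
      exact hpO
    obtain ⟨ε, hε, hball⟩ := Metric.mem_nhds_iff.1 hnhds
    have hd := dense_not_critical_along hN hmd s.cod_mem (convex_ball (s.dom x) ε)
      s.incl.contDiff.contDiffOn (fun y hy => s.incl_mem (hball hy).1) g
      (fun k => EuclideanSpace.single k 1) fun i k y hy => ?_
    · refine ⟨s.dom.source ∩ s.dom ⁻¹' Metric.ball (s.dom x) ε,
        Filter.inter_mem (s.dom.open_source.mem_nhds s.mem_dom)
          (s.dom.continuousAt s.mem_dom (Metric.ball_mem_nhds _ hε)), hd.mono ?_⟩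
      rintro F hF u ⟨hu, huV⟩
      have h3 := hF _ huV
      rw [← s.eq_incl u hu, s.cod.left_inv (s.mapsTo u hu)] at h3
      exact h3
    · have hyt := (hball hy).1
      have hev : (g i).1 ∘ s.cod.symm =ᶠ[𝓝 (s.incl y)] EuclideanSpace.proj (𝕜 := ℝ) i := by
        have h1 : ∀ᶠ z in 𝓝 (s.incl y), s.cod.symm z ∈ O := by
          refine (s.cod.continuousAt_symm (s.incl_mem hyt)).eventually_mem (hO.mem_nhds ?_)
          rw [← s.eq_incl_symm hyt, s.cod.left_inv (s.mapsTo _ (s.dom.map_target hyt))]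
          exact (hball hy).2
        filter_upwards [h1, s.cod.open_target.mem_nhds (s.incl_mem hyt)] with z hz1 hz2
        rw [Function.comp_apply, hg _ hz1 (Or.inl hx), s.cod.right_inv hz2]
        rfl
      rw [hev.fderiv_eq, ContinuousLinearMap.fderiv]
      simp

end

end EquivariantMorse

/-! ### Assembly of the three conditions -/

theorem mainTheorem8 (m k n r N : ℕ) (hk : 0 < k) (hN : 2 ≤ N)
    {Ω : Type*} [TopologicalSpace Ω] [T2Space Ω] [CompactSpace Ω]
    [ChartedSpace (EuclideanSpace ℝ (Fin (m + k))) Ω] [IsManifold (𝓡 (m + k)) ∞ Ω]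
    (M : Set Ω) (hMclosed : IsClosed M)
    [ChartedSpace (EuclideanSpace ℝ (Fin m)) M] [IsManifold (𝓡 m) ∞ M]
    (hM : Manifold.IsSmoothEmbedding (𝓡 m) (𝓡 (m + k)) ∞ (Subtype.val : M → Ω))
    (τ : Ω → Ω) (hτ : ContMDiff (𝓡 (m + k)) (𝓡 (m + k)) ∞ τ) (hττ : Function.Involutive τ)
    (hfix : EquivariantMorse.IsSubmanifold (d := m + k) n (Function.fixedPoints τ))
    (hMfix : EquivariantMorse.IsSubmanifold (d := m + k) r (M ∩ Function.fixedPoints τ))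
    (hrn : (M ∩ Function.fixedPoints τ).Nonempty → r < n) :
    IsOpen {F : EquivariantMorse.InvariantCN (m + k) τ N |
        EquivariantMorse.IsEmbeddedMorse (m + k) m M F.1} ∧
      Dense {F : EquivariantMorse.InvariantCN (m + k) τ N |
        EquivariantMorse.IsEmbeddedMorse (m + k) m M F.1} := by
  have : CompactSpace M := isCompact_iff_compactSpace.1 hMclosed.isCompact
  have hid : Manifold.IsSmoothEmbedding (𝓡 (m + k)) (𝓡 (m + k)) ∞ (id : Ω → Ω) :=
    ⟨Manifold.IsImmersion.id, Topology.IsEmbedding.id⟩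
  -- Condition (1) is the case M = Ω, where the intersection with the fixed set is the whole fixed
  -- set.
  have h1 := EquivariantMorse.isOpen_and_dense_morse (N := N) hN hτ hττ hid
    (by rw [Set.range_id, Set.univ_inter]; exact hfix)
  have h2 := EquivariantMorse.isOpen_and_dense_morse (N := N) hN hτ hττ hM
    (by rw [Subtype.range_coe]; exact hMfix)
  have h3 := EquivariantMorse.isOpen_and_dense_not_critical (N := N) hN hτ hττ (by omega) hM hfix
    (by rw [Subtype.range_coe]; exact hMfix) (by rw [Subtype.range_coe]; exact hrn)
  have e : {F : EquivariantMorse.InvariantCN (m + k) τ N |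
      EquivariantMorse.IsEmbeddedMorse (m + k) m M F.1} =
      ({F | EquivariantMorse.IsMorse (m + k) (F.1 ∘ id)} ∩
        {F | EquivariantMorse.IsMorse m (F.1 ∘ (Subtype.val : M → Ω))}) ∩
        {F | ∀ u : M, ¬ EquivariantMorse.IsCriticalPoint (m + k) F.1 u.1} := by
    ext F
    exact ⟨fun h => ⟨⟨h.morse, h.morse_restrict⟩, fun u => h.not_critical u u.2⟩,
      fun h => ⟨h.1.1, h.1.2, fun u hu => h.2 ⟨u, hu⟩⟩⟩
  rw [e]
  exact ⟨(h1.1.inter h2.1).inter h3.1,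
    (h1.2.inter_of_isOpen_left h2.2 h1.1).inter_of_isOpen_left h3.2 (h1.1.inter h2.1)⟩
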